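/- Let $\kappa_1<\dots<\kappa_n$ be real numbers such that, for each $p$ with $1<p<n$, the sums $\sum_{i\in S}\kappa_i$ over the $p$-element subsets $S\subseteq[n]=\{1,\dots,n\}$ are all distinct. For a $k\times n$ real matrix $A$ let $\Delta_J(A)$ be its maximal minor with column set $J\in\binom{[n]}{k}$. For $\mathcal M\subseteq\binom{[n]}{k}$ the positroid cell $S_{\mathcal M}^{tnn}$ is the set of points of the real Grassmannian $Gr_{k,n}$ represented by matrices $A$ with $\Delta_J(A)>0$ for $J\in\mathcal M$ and $\Delta_J(A)=0$ for $J\notin\mathcal M$. A nonempty cell is irreducible if the reduced row echelon matrix of any of its points has a nonzero entry in every column and, in every row, a nonzero entry other than the pivot. For such a cell let $I_r$ be the lexicographically minimal element of $\mathcal M$ with respect to the order $r<r+1<\dots<n<1<\dots<r-1$; the derangement $\pi(\mathcal I(\mathcal M))$ of the cell is given by $\pi(j)=i$ whenever $I_{i+1}=(I_i\setminus\{i\})\cup\{j\}$, $j\ne i$ (indices modulo $n$), and $S_\pi^{tnn}$ denotes the cell with derangement $\pi$. Let $A$ be a $k\times n$ matrix with all $\Delta_J(A)\ge 0$ that represents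 a point of an irreducible positroid cell $S_{\mathcal M}^{tnn}$. Fix a time $t_0$ and constants $t_4,\dots,t_m$, put $K_J=\prod_{a<b,\ a,b\in J}(\kappa_b-\kappa_a)$ and $$f_A(x,y)=\max_{J\in\mathcal M}\Big\{\ln(\Delta_J(A)K_J)+\sum_{j\in J}\Big(\kappa_jx+\kappa_j^2y+\kappa_j^3t_0+\sum_{\ell=4}^m\kappa_j^\ell t_\ell\Big)\Big\},$$ and let the contour plot $\mathcal C_{t_0}(u_A)$ be the set of points of $\mathbb R^2$ near which $f_A$ is not (affine) linear. Each region of its complement is labeled by the $J$ whose term equals $f_A$ there. A line-soliton is the common boundary of two regions, if it has more than one point; it is of type $[a,b]$, $a<b$, if the labels of the two regions are obtained from one another by exchanging $a$ and $b$. It is an unbounded line-soliton at $y\gg0$ (at $y\ll0$) if $y$ is unbounded above (below) on it. Then there are exactly $k$ unbounded line-solitons at $y\gg0$, each of a unique type $[e_r,j_r]$ with $e_r<j_r$ $(1\le r\le k)$, and exactly $n-k$ unbounded line-solitons at $y\ll0$, each of a unique type $[i_r,g_r]$ with $i_r<g_r$ $(1\le r\le n-k)$. Every element of $[n]$ occurs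 exactly once among the $e_r$ and $g_r$, and setting $\pi(e_r)=j_r$ and $\pi(g_r)=i_r$ defines a permutation $\pi\in S_n$ without fixed points and with exactly $k$ excedances ($a$ with $\pi(a)>a$). Moreover, the point represented by $A$ lies in $S_\pi^{tnn}$; that is, $\pi=\pi(\mathcal I(\mathcal M))$. -/

import Mathlib

open scoped Topology

noncomputable section

namespace KPSoliton

/-! ### The totally non-negative Grassmannian and its positroid cells

Indices `1, …, n` are represented by `Fin n`. -/

/-- The maximal minor `Δ_I(A)` of a `k × n` matrix, for a `k`-element column set `I`
(columns in increasing order); it is `0` if `I` does not have `k` elements. -/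
def minor {k n : ℕ} (A : Matrix (Fin k) (Fin n) ℝ) (I : Finset (Fin n)) : ℝ :=
  if h : I.card = k then (A.submatrix id (I.orderEmbOfFin h)).det else 0

/-- The subspace of `ℝⁿ` spanned by the rows of `A`. -/
def rowSpan {k n : ℕ} (A : Matrix (Fin k) (Fin n) ℝ) : Submodule ℝ (Fin n → ℝ) :=
  Submodule.span ℝ (Set.range fun a : Fin k => A a)

/-- The real Grassmannian of `k`-dimensional subspaces of `ℝⁿ`. -/
def grassmannian (k n : ℕ) : Set (Submodule ℝ (Fin n → ℝ)) :=
  {V | Module.finrank ℝ V = k}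

/-- The set `S_M^{tnn}` of points of the Grassmannian represented by a matrix whose maximal minors
are positive for column sets in `M` and zero for all others. -/
def positroidCell (k n : ℕ) (M : Finset (Finset (Fin n))) : Set (Submodule ℝ (Fin n → ℝ)) :=
  {V | V ∈ grassmannian k n ∧ ∃ A : Matrix (Fin k) (Fin n) ℝ, rowSpan A = V ∧
    (∀ I ∈ M, 0 < minor A I) ∧ ∀ J, J ∉ M → minor A J = 0}

/-- `B` is a full rank matrix in reduced row echelon form, with pivot of row `a` in column `p a`. -/
def IsReducedEchelon {k n : ℕ} (B : Matrix (Fin k) (Fin n) ℝ) (p : Fin k → Fin n) : Prop :=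
  StrictMono p ∧ (∀ a b, B a (p b) = if a = b then 1 else 0) ∧ ∀ a j, j < p a → B a j = 0

/-- `S_M^{tnn}` is an irreducible positroid cell: it is non-empty, and the reduced row echelon
matrix of each of its points has a nonzero entry in each column, and in each row a nonzero entry
besides the pivot. -/
def IsIrreducibleCell (k n : ℕ) (M : Finset (Finset (Fin n))) : Prop :=
  (positroidCell k n M).Nonempty ∧
    ∀ V ∈ positroidCell k n M, ∀ (B : Matrix (Fin k) (Fin n) ℝ) (p : Fin k → Fin n),
      rowSpan B = V → IsReducedEchelon B p →
        (∀ j, ∃ a, B a j ≠ 0) ∧ ∀ a, ∃ j, j ≠ p a ∧ B a j ≠ 0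

/-! ### Grassmann necklaces and derangements -/

/-- The cyclically shifted strict order `r < r+1 < ⋯ < n < 1 < ⋯ < r-1`
(the subtraction of `Fin n` is modulo `n`). -/
def cyclicLT {n : ℕ} (r i j : Fin n) : Prop := i - r < j - r

/-- `I` is strictly smaller than `J` in the lexicographic order on sets of equal size induced by
the shifted order starting at `r`: the first element in which they differ belongs to `I`. -/
def lexLT {n : ℕ} (r : Fin n) (I J : Finset (Fin n)) : Prop :=
  ∃ i ∈ I \ J, ∀ j ∈ J \ I, cyclicLT r i j

/-- `I = (I_1, …, I_n)` is the sequence in which `I_r` is the lexicographically minimal element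
of `M` for the shifted order starting at `r`. -/
def IsNecklaceOf {n : ℕ} (M : Finset (Finset (Fin n))) (I : Fin n → Finset (Fin n)) : Prop :=
  ∀ r, I r ∈ M ∧ ∀ J ∈ M, J ≠ I r → lexLT r (I r) J

/-- `I` is an irreducible Grassmann necklace with `π(I) = π`: always
`I_{i+1} = (I_i \ {i}) ∪ {j}` with `i ∈ I_i` and `j ≠ i`, and `π j = i`
(`finRotate n i` is `i + 1` modulo `n`). -/
def IsNecklacePerm {n : ℕ} (I : Fin n → Finset (Fin n)) (π : Equiv.Perm (Fin n)) : Prop :=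
  ∀ i, i ∈ I i ∧ ∃ j, j ≠ i ∧ I (finRotate n i) = insert j ((I i).erase i) ∧ π j = i

/-- `π = π(I(M))`: the Grassmann necklace of `M` is irreducible, and `π` is its derangement. -/
def IsCellPerm {n : ℕ} (M : Finset (Finset (Fin n))) (π : Equiv.Perm (Fin n)) : Prop :=
  ∃ I : Fin n → Finset (Fin n), IsNecklaceOf M I ∧ IsNecklacePerm I π

/-- The cell `S_π^{tnn}`: the points of the positroid cell `S_M^{tnn}` with `π(I(M)) = π`. -/
def positroidCellOfPerm (k n : ℕ) (π : Equiv.Perm (Fin n)) : Set (Submodule ℝ (Fin n → ℝ)) :=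
  {V | ∃ M, IsCellPerm M π ∧ V ∈ positroidCell k n M}

/-! ### Contour plots -/

/-- Generic parameters: `κ_1 < ⋯ < κ_n`, and for `1 < p < n` the sums of `κ` over the `p`-element
index sets are all distinct. -/
def IsGeneric {n : ℕ} (κ : Fin n → ℝ) : Prop :=
  StrictMono κ ∧ ∀ S T : Finset (Fin n), 1 < S.card → S.card < n → T.card = S.card →
    ∑ i ∈ S, κ i = ∑ i ∈ T, κ i → S = T

/-- The phase `κ_i x + κ_i² y + κ_i³ t + κ_i⁴ t_4 + ⋯ + κ_i^m t_m` at the point `q = (x, y)`. -/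
def phase {n : ℕ} (κ : Fin n → ℝ) (t : ℝ) (m : ℕ) (s : ℕ → ℝ) (i : Fin n) (q : ℝ × ℝ) : ℝ :=
  κ i * q.1 + κ i ^ 2 * q.2 + κ i ^ 3 * t + ∑ l ∈ Finset.Icc 4 m, κ i ^ l * s l

/-- The constant `K_J = ∏_{a < b in J} (κ_b - κ_a)`. -/
def vanderConst {n : ℕ} (κ : Fin n → ℝ) (J : Finset (Fin n)) : ℝ :=
  ∏ c ∈ (J ×ˢ J).filter (fun c => c.1 < c.2), (κ c.2 - κ c.1)

/-- The logarithm of the exponential term `Δ_J(A) E_J` of the `τ`-function. -/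
def logTerm {k n : ℕ} (A : Matrix (Fin k) (Fin n) ℝ) (κ : Fin n → ℝ) (t : ℝ) (m : ℕ) (s : ℕ → ℝ)
    (J : Finset (Fin n)) (q : ℝ × ℝ) : ℝ :=
  Real.log (minor A J * vanderConst κ J) + ∑ i ∈ J, phase κ t m s i q

/-- The function `f_A(·, ·, t)`: the maximum of the logarithms of the terms of the `τ`-function,
over all `J` with `Δ_J(A) ≠ 0`. -/
def maxTerm {k n : ℕ} (A : Matrix (Fin k) (Fin n) ℝ) (κ : Fin n → ℝ) (t : ℝ) (m : ℕ) (s : ℕ → ℝ)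
    (q : ℝ × ℝ) : ℝ :=
  ⨆ J : {J : Finset (Fin n) // minor A J ≠ 0}, logTerm A κ t m s J q

/-- The contour plot `C_t(u_A)`: the points of the `xy`-plane near which `f_A(·, ·, t)` does not
coincide with an affine-linear function. -/
def contourPlot {k n : ℕ} (A : Matrix (Fin k) (Fin n) ℝ) (κ : Fin n → ℝ) (t : ℝ) (m : ℕ)
    (s : ℕ → ℝ) : Set (ℝ × ℝ) :=
  {q | ¬ ∃ g : (ℝ × ℝ) →ᵃ[ℝ] ℝ, maxTerm A κ t m s =ᶠ[𝓝 q] g}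

/-- The region of the complement of the contour plot whose dominant exponential is
`Δ_J(A) E_J` (empty if there is none). -/
def region {k n : ℕ} (A : Matrix (Fin k) (Fin n) ℝ) (κ : Fin n → ℝ) (t : ℝ) (m : ℕ) (s : ℕ → ℝ)
    (J : Finset (Fin n)) : Set (ℝ × ℝ) :=
  {q | minor A J ≠ 0 ∧ q ∉ contourPlot A κ t m s ∧ maxTerm A κ t m s q = logTerm A κ t m s J q}

/-- `L` is the line segment, ray or line of the contour plot that separates the regions with
dominant exponentials `I` and `J`: their common boundary, provided it is more than one point. -/
def Separates {k n : ℕ} (A : Matrix (Fin k) (Fin n) ℝ) (κ : Fin n → ℝ) (t : ℝ) (m : ℕ) (s : ℕ → ℝ)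
    (L : Set (ℝ × ℝ)) (I J : Finset (Fin n)) : Prop :=
  I ≠ J ∧ L = closure (region A κ t m s I) ∩ closure (region A κ t m s J) ∧ L.Nontrivial

/-- `L` is of type `[a, b]`: the dominant exponentials on its two sides have index sets
`{a, m_2, …, m_k}` and `{b, m_2, …, m_k}`. -/
def HasType {k n : ℕ} (A : Matrix (Fin k) (Fin n) ℝ) (κ : Fin n → ℝ) (t : ℝ) (m : ℕ) (s : ℕ → ℝ)
    (L : Set (ℝ × ℝ)) (a b : Fin n) : Prop :=
  ∃ I J, Separates A κ t m s L I J ∧ I \ J = {a} ∧ J \ I = {b}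

/-- The unbounded line-solitons at `y ≫ 0`: the edges of the contour plot that extend to
`y = +∞`. -/
def solitonsAtTop {k n : ℕ} (A : Matrix (Fin k) (Fin n) ℝ) (κ : Fin n → ℝ) (t : ℝ) (m : ℕ)
    (s : ℕ → ℝ) : Set (Set (ℝ × ℝ)) :=
  {L | (∃ I J, Separates A κ t m s L I J) ∧ ∀ Y : ℝ, ∃ q ∈ L, Y < q.2}

/-- The unbounded line-solitons at `y ≪ 0`: the edges of the contour plot that extend to
`y = -∞`. -/
def solitonsAtBot {k n : ℕ} (A : Matrix (Fin k) (Fin n) ℝ) (κ : Fin n → ℝ) (t : ℝ) (m : ℕ)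
    (s : ℕ → ℝ) : Set (Set (ℝ × ℝ)) :=
  {L | (∃ I J, Separates A κ t m s L I J) ∧ ∀ Y : ℝ, ∃ q ∈ L, q.2 < Y}

end KPSoliton

end

/-! A maximal minor is nonzero exactly when its columns form a basis, so `f_A` is a maximum over the
bases `J` of the columns `v i`. Along a line `x = -c y + d` with `σ y → ∞` the term of `J` grows at
the rate `∑ i ∈ J, σ (κ i² - c κ i)`, so the terms dominating far out are the bases of maximal
weight. By the greedy criterion such a basis is unique unless two weights tie, which forces `c = κ a
+ κ b`; genericity makes `a`, `b` the only tied pair. Hence every unbounded edge has such a slope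
and a type `[a, b]`, and it exists precisely when `v a` and `v b` are nonzero and parallel modulo
the heavier vectors (`Link`, `exists_hasType_iff_link`).

The weight of `i` minus that of `a` is `σ (κ i - κ a) (κ i - κ b)`. So the heavier indices lie
outside `[a, b]` for `σ = 1` and strictly between `a` and `b` for `σ = -1`: a cyclic arc in both
cases. Irreducibility makes each `v b` a nonzero combination of the other columns, so going around
the circle from `b` there is a first `a` at which `v b` becomes dependent, and `a ↦ b` is a
derangement `π` (`exists_perm_link`). The same arcs govern the step from `I_i` to `I_{i+1}` in the
Grassmann necklace, whence `π = π(I(M))`. A top edge `[a, b]` means `π a = b`, a bottom edge means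
`π b = a`. The excedances form the lexicographically minimal basis for the usual order, so there are
`k` of them (`card_excedances`). -/

namespace KPSoliton

/-! ### Bases of maximal weight in a family of vectors -/

section Bases

variable {ι E : Type*} [AddCommGroup E] [Module ℝ E]

/-- The vectors indexed by `J` form a basis. -/
def IsBasisSet (v : ι → E) (J : Finset ι) : Prop :=
  LinearIndepOn ℝ v (J : Set ι) ∧ Submodule.span ℝ (v '' J) = ⊤

/-- Modulo the vectors indexed by `S`, the vectors `v a` and `v b` are nonzero and parallel. -/
def Link (v : ι → E) (S : Set ι) (a b : ι) : Prop :=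
  v b ∉ Submodule.span ℝ (v '' S) ∧ v b ∈ Submodule.span ℝ (v '' insert a S)

/-- `J` is a basis of maximal weight. -/
def IsMaxBasis (v : ι → E) (w : ι → ℝ) (J : Finset ι) : Prop :=
  IsBasisSet v J ∧ ∀ K, IsBasisSet v K → ∑ i ∈ K, w i ≤ ∑ i ∈ J, w i

variable {v : ι → E} {w : ι → ℝ} {S T : Set ι} {I J K : Finset ι} {a b i j : ι}

lemma mem_span_mono (h : S ⊆ T) {x : E} (hx : x ∈ Submodule.span ℝ (v '' S)) :
    x ∈ Submodule.span ℝ (v '' T) :=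
  Submodule.span_mono (Set.image_mono h) hx

lemma mem_span_of_mem (h : i ∈ S) : v i ∈ Submodule.span ℝ (v '' S) :=
  Submodule.subset_span (Set.mem_image_of_mem v h)

lemma mem_span_of_forall {x : E} (hx : x ∈ Submodule.span ℝ (v '' S))
    (h : ∀ i ∈ S, v i ∈ Submodule.span ℝ (v '' T)) : x ∈ Submodule.span ℝ (v '' T) := by
  refine Submodule.span_le.2 ?_ hx
  rintro _ ⟨i, hi, rfl⟩
  exact h i hi

lemma Link.left_notMem (h : Link v S a b) : v a ∉ Submodule.span ℝ (v '' S) := fun ha =>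
  h.1 (mem_span_of_forall h.2 fun i hi => by
    rcases hi with rfl | hi
    · exact ha
    · exact mem_span_of_mem hi)

lemma Link.symm (h : Link v S a b) : Link v S b a := by
  refine ⟨h.left_notMem, ?_⟩
  have h2 := h.2
  rw [Set.image_insert_eq] at h2 ⊢
  exact mem_span_insert_exchange h2 h.1

lemma IsBasisSet.mem_span (h : IsBasisSet v J) (x : E) : x ∈ Submodule.span ℝ (v '' J) := by
  rw [h.2]; trivial

lemma IsBasisSet.notMem_span (h : IsBasisSet v J) (hi : i ∈ J) :
    v i ∉ Submodule.span ℝ (v '' (J \ {i} : Set ι)) :=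
  linearIndepOn_iff_notMem_span.1 h.1 i hi

lemma IsBasisSet.card_eq (h : IsBasisSet v J) : J.card = Module.finrank ℝ E := by
  have h1 := h.1.linearIndependent
  have h2 : Submodule.span ℝ (Set.range fun x : (J : Set ι) => v x) = ⊤ := by
    rw [← h.2, Set.image_eq_range]
  simpa using (Module.finrank_eq_card_basis (Module.Basis.mk h1 h2.ge)).symm

lemma IsBasisSet.exchange [DecidableEq ι] (h : IsBasisSet v J) (hi : i ∈ J)
    (hj : v j ∉ Submodule.span ℝ (v '' (J \ {i} : Set ι))) :
    IsBasisSet v (insert j (J.erase i)) := by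
  have hji : j ∉ (J \ {i} : Set ι) := fun h' => hj (mem_span_of_mem h')
  constructor
  · rw [Finset.coe_insert, Finset.coe_erase, linearIndepOn_insert hji]
    exact ⟨h.1.mono Set.sdiff_subset, hj⟩
  · rw [eq_top_iff]
    intro x _
    refine mem_span_of_forall (h.mem_span x) fun l hl => ?_
    rw [Finset.coe_insert, Finset.coe_erase]
    by_cases hli : l = i
    · subst hli
      have h3 := h.mem_span (v j)
      rw [← Set.insert_sdiff_self_of_mem (Finset.mem_coe.2 hi), Set.image_insert_eq] at h3
      rw [Set.image_insert_eq]
      exact mem_span_insert_exchange h3 hj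
    · exact mem_span_of_mem (Or.inr ⟨hl, hli⟩)

/-- In the expansion of `x` in the basis, some index outside `S` must have a nonzero coefficient. -/
lemma IsBasisSet.exists_notMem_span (h : IsBasisSet v J) {x : E}
    (hx : x ∉ Submodule.span ℝ (v '' S)) :
    ∃ j ∈ J, j ∉ S ∧ x ∉ Submodule.span ℝ (v '' (J \ {j} : Set ι)) := by
  classical
  obtain ⟨c, hc⟩ := (Submodule.mem_span_image_finset_iff_exists_fun ℝ).1 (h.mem_span x)
  by_cases hall : ∀ j : J, c j ≠ 0 → (j : ι) ∈ S
  · refine absurd ?_ hx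
    rw [← hc]
    refine Submodule.sum_mem _ fun j _ => ?_
    by_cases hj : c j = 0
    · simp [hj]
    · exact Submodule.smul_mem _ _ (mem_span_of_mem (hall j hj))
  · push Not at hall
    obtain ⟨j, hj0, hjS⟩ := hall
    refine ⟨j, j.2, hjS, fun hxj => h.notMem_span j.2 ?_⟩
    have hsum : ∑ l ∈ Finset.univ.erase j, c l • v l ∈
        Submodule.span ℝ (v '' (J \ {(j : ι)} : Set ι)) :=
      Submodule.sum_mem _ fun l hl => Submodule.smul_mem _ _ (mem_span_of_mem
        ⟨l.2, fun h' => (Finset.mem_erase.1 hl).1 (Subtype.ext h')⟩)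
    have h5 : c j • v j = x - ∑ l ∈ Finset.univ.erase j, c l • v l := by
      rw [← hc, ← Finset.add_sum_erase _ _ (Finset.mem_univ j)]
      simp
    have h6 := Submodule.smul_mem _ (c j)⁻¹ (Submodule.sub_mem _ hxj hsum)
    rwa [← h5, smul_smul, inv_mul_cancel₀ hj0, one_smul] at h6

lemma sum_exchange [DecidableEq ι] (w : ι → ℝ) (hi : i ∈ J) (hj : j ∉ J.erase i) :
    ∑ l ∈ insert j (J.erase i), w l = ∑ l ∈ J, w l + w j - w i := by
  rw [Finset.sum_insert hj, ← Finset.add_sum_erase _ _ hi]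
  ring

/-- A basis of maximal weight admits no improving exchange. -/
lemma IsMaxBasis.le_of_notMem_span (h : IsMaxBasis v w J) (hi : i ∈ J)
    (hj : v j ∉ Submodule.span ℝ (v '' (J \ {i} : Set ι))) : w j ≤ w i := by
  classical
  have h1 := h.2 _ (h.1.exchange hi hj)
  have h2 : j ∉ J.erase i := fun h' => hj (mem_span_of_mem (by simpa [and_comm] using h'))
  rw [sum_exchange w hi h2] at h1
  linarith

/-- No exchange improves `J`, so every vector heavier than `v i` already lies in the span of `J \
{i}`. -/
lemma IsMaxBasis.notMem_span (h : IsMaxBasis v w J) (hi : i ∈ J) :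
    v i ∉ Submodule.span ℝ (v '' {j | w i < w j}) := fun hspan =>
  h.1.notMem_span hi (mem_span_of_forall hspan fun j hj => by
    by_contra hn
    exact absurd (h.le_of_notMem_span hi hn) (not_le.2 hj))

lemma IsMaxBasis.mem_of_notMem_span (h : IsMaxBasis v w J)
    (hi : v i ∉ Submodule.span ℝ (v '' {j | j ≠ i ∧ w i ≤ w j})) : i ∈ J := by
  by_contra hiJ
  obtain ⟨j, hj, hjS, hn⟩ := h.1.exists_notMem_span hi
  exact hjS ⟨fun h' => hiJ (h' ▸ hj), h.le_of_notMem_span hj hn⟩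

/-- The greedy criterion: for an index of untied weight, membership does not depend on which maximal
basis is taken. -/
lemma IsMaxBasis.mem_iff (h : IsMaxBasis v w J) (hi : ∀ j, w j = w i → j = i) :
    i ∈ J ↔ v i ∉ Submodule.span ℝ (v '' {j | w i < w j}) := by
  refine ⟨h.notMem_span, fun hn => h.mem_of_notMem_span fun h' => hn (mem_span_mono ?_ h')⟩
  rintro j ⟨hji, hle⟩
  exact lt_of_le_of_ne hle fun h' => hji (hi j h'.symm)

lemma exists_isMaxBasis [Finite ι] (w : ι → ℝ) (h : IsBasisSet v J) : ∃ K, IsMaxBasis v w K := by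
  classical
  have := Fintype.ofFinite ι
  obtain ⟨K, hK, hmax⟩ := Finset.exists_max_image (Finset.univ.filter fun K => IsBasisSet v K)
    (fun K => ∑ i ∈ K, w i) ⟨J, by simpa using h⟩
  simp only [Finset.mem_filter, Finset.mem_univ, true_and] at hK hmax
  exact ⟨K, hK, hmax⟩

lemma IsMaxBasis.eq_of_injective (hw : Function.Injective w) (hI : IsMaxBasis v w I)
    (hJ : IsMaxBasis v w J) : I = J := by
  ext i
  rw [hI.mem_iff fun _ h => hw h, hJ.mem_iff fun _ h => hw h]

lemma sdiff_eq_of_agree [DecidableEq ι] (hcard : I.card = J.card) (hne : I ≠ J) (hab : a ≠ b)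
    (h : ∀ i, i ≠ a → i ≠ b → (i ∈ I ↔ i ∈ J)) :
    (I \ J = {a} ∧ J \ I = {b}) ∨ (I \ J = {b} ∧ J \ I = {a}) := by
  have hc := Finset.card_sdiff_comm hcard
  have h1 : I \ J ⊆ {a, b} := fun i hi => by
    simp only [Finset.mem_sdiff, Finset.mem_insert, Finset.mem_singleton] at hi ⊢
    by_contra! hn
    exact hi.2 ((h i hn.1 hn.2).1 hi.1)
  have h2 : J \ I ⊆ {a, b} := fun i hi => by
    simp only [Finset.mem_sdiff, Finset.mem_insert, Finset.mem_singleton] at hi ⊢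
    by_contra! hn
    exact hi.2 ((h i hn.1 hn.2).2 hi.1)
  have hpos : (I \ J).Nonempty := by
    rw [Finset.nonempty_iff_ne_empty]
    intro h0
    rw [h0, Finset.card_empty] at hc
    have h0' := Finset.card_eq_zero.1 hc.symm
    exact hne (Finset.Subset.antisymm (Finset.sdiff_eq_empty_iff_subset.1 h0)
      (Finset.sdiff_eq_empty_iff_subset.1 h0'))
  have hpos' : (J \ I).Nonempty := by
    rw [← Finset.card_pos, ← hc]; exact hpos.card_pos
  obtain ⟨x, hx⟩ := hpos
  obtain ⟨y, hy⟩ := hpos'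
  have key : ∀ z ∈ I \ J, z ∉ J \ I := fun z hz hz' => by
    simp only [Finset.mem_sdiff] at hz hz'; exact hz.2 hz'.1
  have aux : ∀ (A B : Finset ι) (x y : ι), A ⊆ {x, y} → x ∈ A → y ∈ B →
      (∀ z ∈ A, z ∉ B) → A = {x} := fun A B x y hA hx hy hAB => by
    refine Finset.eq_singleton_iff_unique_mem.2 ⟨hx, fun z hz => ?_⟩
    rcases Finset.mem_insert.1 (hA hz) with h | h
    · exact h
    · exact absurd hy (Finset.mem_singleton.1 h ▸ hAB z hz)
  have key' : ∀ z ∈ J \ I, z ∉ I \ J := fun z hz hz' => key z hz' hz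
  have h1' := Finset.pair_comm a b ▸ h1
  have h2' := Finset.pair_comm a b ▸ h2
  rcases Finset.mem_insert.1 (h1 hx) with rfl | hxb
  · rcases Finset.mem_insert.1 (h2 hy) with rfl | hyb
    · exact absurd hy (key _ hx)
    · rw [Finset.mem_singleton] at hyb
      subst hyb
      exact Or.inl ⟨aux _ _ _ _ h1 hx hy key, aux _ _ _ _ h2' hy hx key'⟩
  · rw [Finset.mem_singleton] at hxb
    subst hxb
    rcases Finset.mem_insert.1 (h2 hy) with rfl | hyb
    · exact Or.inr ⟨aux _ _ _ _ h1' hx hy key, aux _ _ _ _ h2 hy hx key'⟩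
    · rw [Finset.mem_singleton] at hyb
      subst hyb
      exact absurd hy (key _ hx)

/-- The pair `a`, `b` is the only one of equal weights. -/
def OnlyTie (w : ι → ℝ) (a b : ι) : Prop :=
  a ≠ b ∧ w a = w b ∧ ∀ i j, i ≠ j → w i = w j → i = a ∨ i = b

lemma OnlyTie.symm (h : OnlyTie w a b) : OnlyTie w b a :=
  ⟨h.1.symm, h.2.1.symm, fun i j hij hw => (h.2.2 i j hij hw).symm⟩

lemma OnlyTie.eq_of_ne (h : OnlyTie w a b) (hja : j ≠ a) (hw : w j = w a) : j = b :=
  (h.2.2 j a hja hw).resolve_left hja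

/-- The greedy criterion decides all indices other than `a` and `b`, so two maximal bases can differ
only there. -/
lemma IsMaxBasis.sdiff_eq [DecidableEq ι] (htie : OnlyTie w a b) (hI : IsMaxBasis v w I)
    (hJ : IsMaxBasis v w J) (hne : I ≠ J) :
    (I \ J = {a} ∧ J \ I = {b}) ∨ (I \ J = {b} ∧ J \ I = {a}) := by
  refine sdiff_eq_of_agree (hI.1.card_eq.trans hJ.1.card_eq.symm) hne htie.1 fun i hia hib => ?_
  have hi : ∀ j, w j = w i → j = i := fun j hj => by
    by_contra hji
    rcases htie.2.2 i j (Ne.symm hji) hj.symm with h | h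
    · exact hia h
    · exact hib h
  rw [hI.mem_iff hi, hJ.mem_iff hi]

lemma IsMaxBasis.eq_of_mem (htie : OnlyTie w a b) (hI : IsMaxBasis v w I)
    (hJ : IsMaxBasis v w J) (haI : a ∈ I) (haJ : a ∈ J) : I = J := by
  classical
  by_contra hne
  rcases hI.sdiff_eq htie hJ hne with ⟨h, -⟩ | ⟨-, h⟩
  · exact (Finset.mem_sdiff.1 (by rw [h]; simp : a ∈ I \ J)).2 haJ
  · exact (Finset.mem_sdiff.1 (by rw [h]; simp : a ∈ J \ I)).2 haI

lemma IsMaxBasis.link (htie : OnlyTie w a b) (hI : IsMaxBasis v w I) (hJ : IsMaxBasis v w J)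
    (hbJ : b ∈ J) (hbI : b ∉ I) : Link v {i | w a < w i} a b := by
  refine ⟨htie.2.1 ▸ hJ.notMem_span hbJ, ?_⟩
  by_contra hn
  refine hbI (hI.mem_of_notMem_span fun h' => hn (mem_span_mono ?_ h'))
  rintro j ⟨hjb, hle⟩
  rcases hle.lt_or_eq with h | h
  · exact Or.inr (show w a < w j from htie.2.1 ▸ h)
  · exact Or.inl (htie.symm.eq_of_ne hjb h.symm)

/-- A maximal basis cannot contain both, since `v b` depends on `v a` and heavier vectors. It cannot
miss both, since expanding `v a` needs a basis element of weight exactly `w a`. -/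
lemma Link.exists_isMaxBasis_mem [Finite ι] (htie : OnlyTie w a b)
    (hab : Link v {i | w a < w i} a b) (hK : IsBasisSet v K) :
    ∃ I, IsMaxBasis v w I ∧ ((a ∈ I ∧ b ∉ I) ∨ (b ∈ I ∧ a ∉ I)) := by
  obtain ⟨I, hI⟩ := exists_isMaxBasis w hK
  refine ⟨I, hI, ?_⟩
  by_cases haI : a ∈ I
  · left
    refine ⟨haI, fun hbI => hI.1.notMem_span hbI (mem_span_of_forall hab.2 fun j hj => ?_)⟩
    rcases hj with rfl | hj
    · exact mem_span_of_mem ⟨haI, htie.1⟩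
    · by_contra hn
      have := hI.le_of_notMem_span hbI hn
      rw [← htie.2.1] at this
      exact absurd this (not_le.2 hj)
  · right
    refine ⟨?_, haI⟩
    by_contra hbI
    obtain ⟨j, hjI, hjS, hn⟩ := hI.1.exists_notMem_span hab.left_notMem
    have hle := hI.le_of_notMem_span hjI hn
    have hj := htie.eq_of_ne (j := j) (fun h => haI (h ▸ hjI)) (le_antisymm (not_lt.1 hjS) hle)
    exact hbI (hj ▸ hjI)

lemma IsMaxBasis.exchange [DecidableEq ι] (htie : OnlyTie w a b)
    (hab : Link v {i | w a < w i} a b) (hI : IsMaxBasis v w I) (haI : a ∈ I) (hbI : b ∉ I) :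
    IsMaxBasis v w (insert b (I.erase a)) := by
  have hb : v b ∉ Submodule.span ℝ (v '' (I \ {a} : Set ι)) := fun hb => by
    refine hI.1.notMem_span haI (mem_span_of_forall hab.symm.2 fun j hj => ?_)
    rcases hj with rfl | hj
    · exact hb
    · by_contra hn
      exact absurd (hI.le_of_notMem_span haI hn) (not_le.2 hj)
  refine ⟨hI.1.exchange haI hb, fun K hK => ?_⟩
  rw [sum_exchange w haI (fun h => hbI (Finset.mem_of_mem_erase h)), htie.2.1]
  simpa using hI.2 K hK

/-- A linked pair of equal weight gives exactly two bases of maximal weight. -/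
lemma Link.exists_pair [Finite ι] [DecidableEq ι] (htie : OnlyTie w a b)
    (hab : Link v {i | w a < w i} a b) (hK : IsBasisSet v K) :
    ∃ I J, IsMaxBasis v w I ∧ IsMaxBasis v w J ∧ I \ J = {a} ∧ J \ I = {b} ∧
      ∀ L, IsMaxBasis v w L → L = I ∨ L = J := by
  -- Stated for arbitrary `a`, `b` because the maximal basis found first may contain either one of
  -- the tied pair.
  have main : ∀ a b I, OnlyTie w a b → Link v {i | w a < w i} a b → IsMaxBasis v w I → a ∈ I →
      b ∉ I → ∃ J, IsMaxBasis v w J ∧ I \ J = {a} ∧ J \ I = {b} ∧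
        ∀ L, IsMaxBasis v w L → L = I ∨ L = J := by
    intro a b I htie hab hI haI hbI
    have h1 : I \ insert b (I.erase a) = {a} := by
      ext i
      simp only [Finset.mem_sdiff, Finset.mem_insert, Finset.mem_erase, Finset.mem_singleton]
      constructor
      · rintro ⟨hi, hn⟩
        by_contra hia
        exact hn (Or.inr ⟨hia, hi⟩)
      · rintro rfl
        exact ⟨haI, fun h => h.elim htie.1 fun h' => h'.1 rfl⟩
    have h2 : insert b (I.erase a) \ I = {b} := by
      ext i
      simp only [Finset.mem_sdiff, Finset.mem_insert, Finset.mem_erase, Finset.mem_singleton]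
      constructor
      · rintro ⟨hi | hi, hn⟩
        · exact hi
        · exact absurd hi.2 hn
      · rintro rfl
        exact ⟨Or.inl rfl, hbI⟩
    refine ⟨_, hI.exchange htie hab haI hbI, h1, h2, fun L hL => ?_⟩
    by_contra! hne
    rcases hI.sdiff_eq htie hL hne.1.symm with ⟨h3, h4⟩ | ⟨h3, -⟩
    · refine hne.2 ?_
      ext x
      have h3x := Finset.ext_iff.1 h3 x
      have h4x := Finset.ext_iff.1 h4 x
      simp only [Finset.mem_sdiff, Finset.mem_singleton] at h3x h4x
      rw [Finset.mem_insert, Finset.mem_erase]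
      tauto
    · have : b ∈ I \ L := by rw [h3]; simp
      exact hbI (Finset.mem_sdiff.1 this).1
  obtain ⟨I, hI, ⟨haI, hbI⟩ | ⟨hbI, haI⟩⟩ := hab.exists_isMaxBasis_mem htie hK
  · obtain ⟨J, h1, h2, h3, h4⟩ := main a b I htie hab hI haI hbI
    exact ⟨I, J, hI, h1, h2, h3, h4⟩
  · obtain ⟨J, h1, h2, h3, h4⟩ := main b a I htie.symm (htie.2.1 ▸ hab.symm) hI hbI haI
    exact ⟨J, I, h1, hI, h3, h2, fun L hL => (h4 L hL).symm⟩

end Bases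

/-! ### Cyclic intervals and Grassmann necklaces -/

section Cyclic

variable {n : ℕ}

lemma val_sub_eq (i r : Fin n) :
    ((i - r : Fin n) : ℕ) = if r ≤ i then (i : ℕ) - r else n + i - r := by
  split_ifs with h
  · exact Fin.sub_val_of_le h
  · exact Fin.coe_sub_iff_lt.2 (not_le.1 h)

lemma cyclicLT_iff (r i j : Fin n) :
    cyclicLT r i j ↔ (r ≤ i ∧ i < j) ∨ (i < j ∧ j < r) ∨ (j < r ∧ r ≤ i) := by
  have hi := i.2
  have hj := j.2
  have hr := r.2
  rw [cyclicLT, Fin.lt_def, val_sub_eq, val_sub_eq]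
  simp only [Fin.le_def, Fin.lt_def]
  split_ifs <;> omega

/-- The open cyclic interval from `i` to `l`. -/
def arc (i l : Fin n) : Set (Fin n) := {j | j ≠ i ∧ cyclicLT i j l}

lemma mem_arc (i l j : Fin n) :
    j ∈ arc i l ↔ (i < j ∧ j < l) ∨ (j < l ∧ l < i) ∨ (l < i ∧ i < j) := by
  rw [arc, Set.mem_ofPred_eq, cyclicLT_iff]
  omega

lemma cyclicLT_irrefl (r i : Fin n) : ¬ cyclicLT r i i := lt_irrefl _

lemma cyclicLT_trans {r i j l : Fin n} (h : cyclicLT r i j) (h' : cyclicLT r j l) :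
    cyclicLT r i l := lt_trans h h'

lemma cyclicLT_or {i j : Fin n} (r : Fin n) (h : i ≠ j) : cyclicLT r i j ∨ cyclicLT r j i := by
  rw [cyclicLT_iff, cyclicLT_iff]
  omega

/-- Starting at `i + 1` moves `i` from the first place to the last; with `cyclicLT_iff_arc` this
isolates the effect of one necklace step. -/
lemma cyclicLT_finRotate (i j l : Fin n) :
    cyclicLT (finRotate n i) j l ↔ (l = i ∧ j ≠ i) ∨ j ∈ arc i l := by
  obtain _ | n := n
  · exact i.elim0
  have hi := i.2
  have hj := j.2
  have hl := l.2
  rw [cyclicLT_iff, mem_arc]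
  simp only [Fin.le_def, Fin.lt_def, coe_finRotate, ne_eq, Fin.ext_iff, Fin.val_last]
  split_ifs <;> omega

lemma cyclicLT_iff_arc {i l : Fin n} (h : l ≠ i) (j : Fin n) :
    cyclicLT i j l ↔ j ∈ insert i (arc i l) := by
  rw [Set.mem_insert_iff, mem_arc, cyclicLT_iff]
  omega

variable {E : Type*} [AddCommGroup E] [Module ℝ E] {v : Fin n → E}

open Classical in
/-- The lexicographically minimal basis for the cyclic order starting at `r`. -/
noncomputable def lexMinBasis (v : Fin n → E) (r : Fin n) : Finset (Fin n) :=
  Finset.univ.filter fun i => v i ∉ Submodule.span ℝ (v '' {j | cyclicLT r j i})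

lemma mem_lexMinBasis {r i : Fin n} :
    i ∈ lexMinBasis v r ↔ v i ∉ Submodule.span ℝ (v '' {j | cyclicLT r j i}) := by
  simp [lexMinBasis]

lemma isBasisSet_lexMinBasis {J : Finset (Fin n)} (hJ : IsBasisSet v J) (r : Fin n) :
    IsBasisSet v (lexMinBasis v r) := by
  -- The weight decreases with the position in the shifted order, so heavier means earlier.
  obtain ⟨K, hK⟩ := exists_isMaxBasis (fun i : Fin n => -(((i - r : Fin n) : ℕ) : ℝ)) hJ
  convert hK.1 using 1
  ext i
  rw [mem_lexMinBasis, hK.mem_iff]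
  · simp only [cyclicLT, Fin.lt_def, neg_lt_neg_iff, Nat.cast_lt]
  · intro j hj
    simp only [neg_inj, Nat.cast_inj] at hj
    by_contra hne
    rcases cyclicLT_or r hne with h | h <;> rw [cyclicLT, Fin.lt_def] at h <;> omega

lemma mem_span_lexMinBasis (v : Fin n → E) (r i : Fin n) : v i ∈ Submodule.span ℝ
    (v '' {j | j ∈ lexMinBasis v r ∧ (j = i ∨ cyclicLT r j i)}) := by
  induction h : ((i - r : Fin n) : ℕ) using Nat.strong_induction_on generalizing i with
  | _ d ih =>
    by_cases hi : i ∈ lexMinBasis v r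
    · exact mem_span_of_mem ⟨hi, Or.inl rfl⟩
    · rw [mem_lexMinBasis, not_not] at hi
      refine mem_span_of_forall hi fun j hj => ?_
      refine mem_span_mono ?_ (ih _ (h ▸ Fin.lt_def.1 hj) j rfl)
      rintro l ⟨hl, rfl | hlj⟩
      · exact ⟨hl, Or.inr hj⟩
      · exact ⟨hl, Or.inr (cyclicLT_trans hlj hj)⟩

/-- If the first difference `i` belonged to `J`, then `v i` would be spanned by earlier elements of
the minimal basis, all of which are in `J`. -/
lemma lexLT_lexMinBasis {J : Finset (Fin n)} (hJ : IsBasisSet v J) (r : Fin n)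
    (hne : J ≠ lexMinBasis v r) : lexLT r (lexMinBasis v r) J := by
  set G := lexMinBasis v r with hG
  have hnon : (G \ J ∪ J \ G).Nonempty := by
    rw [Finset.nonempty_iff_ne_empty]
    intro h
    rw [Finset.union_eq_empty, Finset.sdiff_eq_empty_iff_subset,
      Finset.sdiff_eq_empty_iff_subset] at h
    exact hne (Finset.Subset.antisymm h.2 h.1)
  obtain ⟨i, hi, hmin⟩ := Finset.exists_min_image _ (fun i => i - r) hnon
  rcases Finset.mem_union.1 hi with hi | hi
  · refine ⟨i, hi, fun j hj => (cyclicLT_or r ?_).resolve_right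
      (not_lt.2 (hmin j (Finset.mem_union_right _ hj)))⟩
    rintro rfl
    exact (Finset.mem_sdiff.1 hi).2 (Finset.mem_sdiff.1 hj).1
  · rw [Finset.mem_sdiff] at hi
    have h1 := hi.2
    rw [hG, mem_lexMinBasis, not_not] at h1
    refine absurd (mem_span_of_forall h1 fun j hj => ?_) (hJ.notMem_span hi.1)
    refine mem_span_mono ?_ (mem_span_lexMinBasis v r j)
    rintro l ⟨hlG, hl⟩
    have hli : cyclicLT r l i := hl.elim (fun h => h ▸ hj) fun h => cyclicLT_trans h hj
    refine ⟨?_, fun h => cyclicLT_irrefl r i (by rwa [Set.mem_singleton_iff.1 h] at hli)⟩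
    by_contra hlJ
    exact absurd hli (not_lt.2 (hmin l (Finset.mem_union_left _ (Finset.mem_sdiff.2 ⟨hlG, hlJ⟩))))

/-- The first vector after `v i` with which `v i` depends on the vectors between them. -/
lemma exists_link (i : Fin n) (h0 : v i ≠ 0) (h1 : v i ∈ Submodule.span ℝ (v '' {i}ᶜ)) :
    ∃ l, l ≠ i ∧ Link v (arc i l) l i := by
  classical
  -- The index `l` is the cyclically last element of `S`, so any dependence of `v i` is supported on
  -- an arc with its endpoint.
  have key : ∀ S : Set (Fin n), i ∉ S → v i ∈ Submodule.span ℝ (v '' S) →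
      ∃ l ∈ S, S ⊆ insert l (arc i l) := by
    intro S hiS hS
    have hne : S.toFinset.Nonempty := by
      rw [Set.toFinset_nonempty]
      by_contra hemp
      rw [Set.not_nonempty_iff_eq_empty] at hemp
      simp only [hemp, Set.image_empty, Submodule.span_empty, Submodule.mem_bot] at hS
      exact h0 hS
    obtain ⟨l, hl, hmax⟩ := Finset.exists_max_image _ (fun j => j - i) hne
    rw [Set.mem_toFinset] at hl
    refine ⟨l, hl, fun j hj => ?_⟩
    by_cases hjl : j = l
    · exact Or.inl hjl
    · refine Or.inr ⟨fun h => hiS (h ▸ hj), (cyclicLT_or i hjl).resolve_right (not_lt.2 ?_)⟩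
      exact hmax j (Set.mem_toFinset.2 hj)
  obtain ⟨l, hl, hsub⟩ := key {i}ᶜ (by simp) h1
  obtain ⟨l, hl, hmin⟩ := Finset.exists_min_image
    (Finset.univ.filter fun l => l ≠ i ∧ v i ∈ Submodule.span ℝ (v '' insert l (arc i l)))
    (fun l => l - i) ⟨l, by simpa using ⟨hl, mem_span_mono hsub h1⟩⟩
  simp only [Finset.mem_filter, Finset.mem_univ, true_and] at hl hmin
  refine ⟨l, hl.1, fun h => ?_, hl.2⟩
  -- A dependence on the open arc alone would end at some `l'` nearer to `i` than the minimal `l`.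
  obtain ⟨l', hl', hsub⟩ := key (arc i l) (fun h => h.1 rfl) h
  exact absurd hl'.2 (not_lt.2 (hmin l' ⟨hl'.1, mem_span_mono hsub h⟩))

lemma Link.eq_of_arc_left {a a' b : Fin n} (ha : a ≠ b) (ha' : a' ≠ b)
    (h : Link v (arc b a) a b) (h' : Link v (arc b a') a' b) : a = a' := by
  by_contra hne
  have key : ∀ a a', a' ≠ b → Link v (arc b a) a b → Link v (arc b a') a' b → ¬ cyclicLT b a' a :=
    fun a a' ha' h h' hlt => h.1 (mem_span_mono (by
      rintro j (rfl | hj)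
      · exact ⟨ha', hlt⟩
      · exact ⟨hj.1, cyclicLT_trans hj.2 hlt⟩) h'.2)
  exact (cyclicLT_or b hne).elim (key _ _ ha h' h) (key _ _ ha' h h')

/-- By symmetry of `Link`, `b` is the first index at which `v a` becomes dependent when going
backwards from `a`. This gives injectivity of the map `b ↦ a`. -/
lemma Link.eq_of_arc_right {a b b' : Fin n} (hb : b ≠ a) (hb' : b' ≠ a)
    (h : Link v (arc b a) a b) (h' : Link v (arc b' a) a b') : b = b' := by
  by_contra hne
  have key : ∀ b b', b ≠ a → b' ≠ a → Link v (arc b a) a b → Link v (arc b' a) a b' →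
      b' ∉ arc b a := fun b b' hb hb' h h' hmem => h.left_notMem (mem_span_mono (by
      rintro j (rfl | hj)
      · exact hmem
      · rw [mem_arc] at hj hmem ⊢
        omega) h'.symm.2)
  have : b' ∈ arc b a ∨ b ∈ arc b' a := by
    rw [mem_arc, mem_arc]
    omega
  exact this.elim (key _ _ hb hb' h h') (key _ _ hb' hb h' h)

/-- A family of vectors, each a nonzero combination of the others, has a derangement that maps `a`
to the index `b` linked with it. -/
lemma exists_perm_link (h0 : ∀ i, v i ≠ 0) (h1 : ∀ i, v i ∈ Submodule.span ℝ (v '' {i}ᶜ)) :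
    ∃ π : Equiv.Perm (Fin n), (∀ a, π a ≠ a) ∧ ∀ a b, a ≠ b → (Link v (arc b a) a b ↔ π a = b) := by
  choose f hf hl using fun i => exists_link i (h0 i) (h1 i)
  have hinj : Function.Injective f := fun b b' h =>
    Link.eq_of_arc_right (hf b).symm (h ▸ (hf b').symm) (hl b) (h ▸ hl b')
  refine ⟨(Equiv.ofBijective f (Finite.injective_iff_bijective.1 hinj)).symm, fun a h => ?_,
    fun a b hab => ?_⟩
  · rw [Equiv.symm_apply_eq] at h
    exact hf a h.symm
  · rw [Equiv.symm_apply_eq, Equiv.ofBijective_apply]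
    refine ⟨fun h => Link.eq_of_arc_left hab (hf b) h (hl b), ?_⟩
    rintro rfl
    exact hl b

variable {π : Equiv.Perm (Fin n)}

/-- From start `i` to start `i + 1`, an index `l ≠ i` only loses `v i` from its predecessors. It
newly enters the basis exactly when `v i` was needed to span `v l`, which is the link giving `π l =
i`. -/
lemma isNecklacePerm_lexMinBasis (h0 : ∀ i, v i ≠ 0)
    (h1 : ∀ i, v i ∈ Submodule.span ℝ (v '' {i}ᶜ)) (hπ : ∀ a, π a ≠ a)
    (hl : ∀ a b, a ≠ b → (Link v (arc b a) a b ↔ π a = b)) :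
    IsNecklacePerm (lexMinBasis v) π := by
  intro i
  refine ⟨?_, π.symm i, fun h => ?_, ?_, π.apply_symm_apply i⟩
  · rw [mem_lexMinBasis]
    have : {j | cyclicLT i j i} = ∅ := by
      ext j; simp [cyclicLT_iff]
    simpa [this] using h0 i
  · rw [Equiv.symm_apply_eq] at h
    exact hπ i h.symm
  · ext l
    rw [Finset.mem_insert, Finset.mem_erase, mem_lexMinBasis, mem_lexMinBasis]
    simp only [cyclicLT_finRotate]
    by_cases hli : l = i
    -- The index `i` is now last, and its vector is spanned by all the others, so it drops out.
    · subst hli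
      have h2 : {j | (l = l ∧ j ≠ l) ∨ j ∈ arc l l} = {l}ᶜ := by
        ext j
        simp only [true_and, Set.mem_ofPred_eq, mem_arc, Set.mem_compl_iff, Set.mem_singleton_iff]
        omega
      rw [h2]
      have : l ≠ π.symm l := fun h => hπ l (by rw [eq_comm, ← Equiv.symm_apply_eq, ← h])
      simp [h1 l, this]
    · have h2 : {j | (l = i ∧ j ≠ i) ∨ j ∈ arc i l} = arc i l := by ext j; simp [hli]
      have h3 : {j | cyclicLT i j l} = insert i (arc i l) := by
        ext j; exact cyclicLT_iff_arc hli j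
      have h4 := hl l i hli
      rw [Equiv.eq_symm_apply, ← h4, h2, h3]
      constructor
      · intro h
        by_cases h5 : v l ∈ Submodule.span ℝ (v '' insert i (arc i l))
        · exact Or.inl (Link.symm ⟨h, h5⟩)
        · exact Or.inr ⟨hli, h5⟩
      · rintro (h | ⟨-, h⟩) h'
        · exact h.left_notMem h'
        · exact h (mem_span_mono (Set.subset_insert _ _) h')

/-- The arc from `π a` to `a` contains all predecessors of `a` if `a < π a`; otherwise the arc and
its endpoint `π a` consist of predecessors. So the excedances are exactly the minimal basis for the
order starting at `0`. -/
lemma card_excedances {J : Finset (Fin n)} (hJ : IsBasisSet v J) (hπ : ∀ a, π a ≠ a)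
    (hl : ∀ a b, a ≠ b → (Link v (arc b a) a b ↔ π a = b)) :
    (Finset.univ.filter fun a => a < π a).card = J.card := by
  obtain _ | n := n
  · simp [Finset.eq_empty_of_isEmpty]
  rw [hJ.card_eq, ← (isBasisSet_lexMinBasis hJ 0).card_eq]
  congr 1
  ext a
  rw [mem_lexMinBasis, Finset.mem_filter]
  simp only [Finset.mem_univ, true_and]
  have h := (hl a (π a) (hπ a).symm).2 rfl
  constructor
  · intro hlt hs
    refine h.left_notMem (mem_span_mono ?_ hs)
    intro j hj
    rw [Set.mem_ofPred_eq, cyclicLT_iff] at hj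
    rw [mem_arc]
    simp only [Fin.not_lt_zero, Fin.zero_le] at hj
    have : j < a := by tauto
    tauto
  · intro hs
    by_contra hlt
    have hlt' : π a < a := lt_of_le_of_ne (not_lt.1 hlt) (hπ a)
    refine hs (mem_span_mono ?_ h.symm.2)
    rintro j (rfl | hj)
    · rw [Set.mem_ofPred_eq, cyclicLT_iff]
      exact Or.inl ⟨Fin.zero_le _, hlt'⟩
    · rw [mem_arc] at hj
      rw [Set.mem_ofPred_eq, cyclicLT_iff]
      refine Or.inl ⟨Fin.zero_le _, ?_⟩
      omega

end Cyclic

/-! ### Maximal minors and bases of columns -/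

section Minors

variable {k n : ℕ} {A : Matrix (Fin k) (Fin n) ℝ} {J : Finset (Fin n)}

lemma isBasisSet_col_iff :
    IsBasisSet A.col J ↔ J.card = k ∧ LinearIndepOn ℝ A.col (J : Set (Fin n)) := by
  refine ⟨fun h => ⟨by simpa using h.card_eq, h.1⟩, fun ⟨hc, hl⟩ => ⟨hl, ?_⟩⟩
  have := hl.linearIndependent.span_eq_top_of_card_eq_finrank' (by simpa using hc)
  rwa [Set.image_eq_range]

lemma linearIndepOn_col_iff (h : J.card = k) :
    LinearIndepOn ℝ A.col (J : Set (Fin n)) ↔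
      IsUnit (A.submatrix id (J.orderEmbOfFin h)) := by
  rw [← Matrix.linearIndependent_cols_iff_isUnit]
  exact (linearIndependent_equiv (J.orderIsoOfFin h).toEquiv
    (f := fun x : (J : Set (Fin n)) => A.col x)).symm

lemma minor_ne_zero_iff : minor A J ≠ 0 ↔ IsBasisSet A.col J := by
  rw [isBasisSet_col_iff, minor]
  split_ifs with h
  · rw [linearIndepOn_col_iff h, Matrix.isUnit_iff_isUnit_det, isUnit_iff_ne_zero]
    simp [h]
  · simp [h]

end Minors

/-! ### Regions of the contour plot -/

section Contour

variable {k n : ℕ} {A : Matrix (Fin k) (Fin n) ℝ} {κ : Fin n → ℝ} {t : ℝ} {m : ℕ} {s : ℕ → ℝ}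
  {I J K : Finset (Fin n)} {q : ℝ × ℝ} {L : Set (ℝ × ℝ)}

/-- All times, the minor and `K_J` enter only the constant term of an affine function of `(x, y)`.
-/
lemma logTerm_eq (A : Matrix (Fin k) (Fin n) ℝ) (κ : Fin n → ℝ) (t : ℝ) (m : ℕ) (s : ℕ → ℝ)
    (J : Finset (Fin n)) (q : ℝ × ℝ) :
    logTerm A κ t m s J q =
      logTerm A κ t m s J 0 + (∑ i ∈ J, κ i) * q.1 + (∑ i ∈ J, κ i ^ 2) * q.2 := by
  simp only [logTerm, phase, Prod.fst_zero, Prod.snd_zero, Finset.sum_mul, Finset.sum_add_distrib,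
    mul_zero, Finset.sum_const_zero]
  ring

lemma continuous_logTerm : Continuous (logTerm A κ t m s J) := by
  have : logTerm A κ t m s J = fun q => logTerm A κ t m s J 0 + (∑ i ∈ J, κ i) * q.1 +
      (∑ i ∈ J, κ i ^ 2) * q.2 := funext (logTerm_eq A κ t m s J)
  rw [this]
  fun_prop

lemma logTerm_le_maxTerm (hJ : minor A J ≠ 0) (q : ℝ × ℝ) :
    logTerm A κ t m s J q ≤ maxTerm A κ t m s q :=
  le_ciSup (f := fun J : {J : Finset (Fin n) // minor A J ≠ 0} => logTerm A κ t m s J q)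
    (Set.finite_range _).bddAbove ⟨J, hJ⟩

lemma minor_ne_zero_of_mem_closure (hq : q ∈ closure (region A κ t m s J)) : minor A J ≠ 0 := by
  obtain ⟨p, hp⟩ := closure_nonempty_iff.1 ⟨q, hq⟩
  exact hp.1

lemma logTerm_le_of_mem_closure (hq : q ∈ closure (region A κ t m s J)) (hK : minor A K ≠ 0) :
    logTerm A κ t m s K q ≤ logTerm A κ t m s J q := by
  have hcl : IsClosed {q | logTerm A κ t m s K q ≤ logTerm A κ t m s J q} :=
    isClosed_le continuous_logTerm continuous_logTerm
  refine closure_minimal (fun p hp => ?_) hcl hq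
  exact (logTerm_le_maxTerm hK p).trans hp.2.2.le

lemma maxTerm_eq (hJ : minor A J ≠ 0)
    (h : ∀ K, minor A K ≠ 0 → logTerm A κ t m s K q ≤ logTerm A κ t m s J q) :
    maxTerm A κ t m s q = logTerm A κ t m s J q := by
  have : Nonempty {J : Finset (Fin n) // minor A J ≠ 0} := ⟨⟨J, hJ⟩⟩
  exact le_antisymm (ciSup_le fun K => h K K.2) (logTerm_le_maxTerm hJ q)

lemma mem_region (hJ : minor A J ≠ 0)
    (h : ∀ K, minor A K ≠ 0 → K ≠ J → logTerm A κ t m s K q < logTerm A κ t m s J q) :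
    q ∈ region A κ t m s J := by
  have hev : ∀ᶠ p in 𝓝 q, maxTerm A κ t m s p = logTerm A κ t m s J p := by
    have h1 : ∀ᶠ p in 𝓝 q, ∀ K, minor A K ≠ 0 → K ≠ J →
        logTerm A κ t m s K p < logTerm A κ t m s J p := by
      rw [Filter.eventually_all]
      intro K
      by_cases hK : minor A K ≠ 0 ∧ K ≠ J
      · filter_upwards [continuous_logTerm.continuousAt.eventually_lt
          continuous_logTerm.continuousAt (h K hK.1 hK.2)] with p hp _ _ using hp
      · exact Filter.Eventually.of_forall fun p h1 h2 => absurd ⟨h1, h2⟩ hK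
    filter_upwards [h1] with p hp
    refine maxTerm_eq hJ fun K hK => ?_
    by_cases hKJ : K = J
    · rw [hKJ]
    · exact (hp K hK hKJ).le
  refine ⟨hJ, fun hq => hq ⟨AffineMap.mk' (logTerm A κ t m s J)
    ((∑ i ∈ J, κ i) • LinearMap.fst ℝ ℝ ℝ + (∑ i ∈ J, κ i ^ 2) • LinearMap.snd ℝ ℝ ℝ) 0
    fun p => ?_, hev⟩, hev.self_of_nhds⟩
  rw [logTerm_eq]
  simp only [LinearMap.add_apply, LinearMap.smul_apply, LinearMap.fst_apply, LinearMap.snd_apply,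
    vsub_eq_sub, vadd_eq_add, sub_zero, smul_eq_mul]
  ring

/-- A point at which exactly two terms are dominant lies in the closure of the region of each. -/
lemma mem_closure_region (hI : minor A I ≠ 0) (hX : ∑ i ∈ I, κ i ≠ ∑ i ∈ J, κ i)
    (hIJ : logTerm A κ t m s J q ≤ logTerm A κ t m s I q)
    (h : ∀ K, minor A K ≠ 0 → K ≠ I → K ≠ J → logTerm A κ t m s K q < logTerm A κ t m s I q) :
    q ∈ closure (region A κ t m s I) := by
  -- This horizontal shift raises term `I` over term `J` by `ε` times the square of the difference
  -- of the sums.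
  let f : ℝ → ℝ × ℝ := fun ε => (q.1 + ε * (∑ i ∈ I, κ i - ∑ i ∈ J, κ i), q.2)
  have hf : Continuous f := by fun_prop
  have hf0 : f 0 = q := by simp [f]
  have ht : Filter.Tendsto f (𝓝[>] 0) (𝓝 q) := by
    have := hf.tendsto 0
    rw [hf0] at this
    exact this.mono_left nhdsWithin_le_nhds
  refine mem_closure_of_tendsto ht ?_
  have h1 : ∀ᶠ ε in 𝓝[>] (0 : ℝ), ∀ K, minor A K ≠ 0 → K ≠ I → K ≠ J →
      logTerm A κ t m s K (f ε) < logTerm A κ t m s I (f ε) := by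
    rw [Filter.eventually_all]
    intro K
    by_cases hK : minor A K ≠ 0 ∧ K ≠ I ∧ K ≠ J
    · have h2 := (continuous_logTerm.tendsto q).eventually_lt (continuous_logTerm.tendsto q)
        (h K hK.1 hK.2.1 hK.2.2)
      filter_upwards [ht.eventually h2] with ε hε _ _ _ using hε
    · exact Filter.Eventually.of_forall fun p h1 h2 h3 => absurd ⟨h1, h2, h3⟩ hK
  filter_upwards [h1, self_mem_nhdsWithin] with ε hε hpos
  refine mem_region hI fun K hK hKI => ?_
  by_cases hKJ : K = J
  · subst hKJ
    rw [logTerm_eq A κ t m s K, logTerm_eq A κ t m s I] at hIJ ⊢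
    have h3 : 0 < (∑ i ∈ I, κ i - ∑ i ∈ K, κ i) ^ 2 := by
      have := sub_ne_zero.2 hX
      positivity
    have h4 := mul_pos (Set.mem_Ioi.1 hpos) h3
    simp only [f]
    nlinarith
  · exact hε K hK hKI hKJ

end Contour

/-! ### Unbounded line-solitons and bases of maximal weight -/

section Asymptotics

variable {k n : ℕ} {A : Matrix (Fin k) (Fin n) ℝ} {κ : Fin n → ℝ} {t : ℝ} {m : ℕ} {s : ℕ → ℝ}
  {I J K : Finset (Fin n)} {q : ℝ × ℝ} {L L' : Set (ℝ × ℝ)} {σ c : ℝ} {a b a' b' : Fin n}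

/-- Extends genericity to the sizes `0`, `1` and `n`, where it is trivial or follows from strict
monotonicity. -/
lemma IsGeneric.eq_of_sum_eq (hκ : IsGeneric κ) (hcard : I.card = J.card)
    (hsum : ∑ i ∈ I, κ i = ∑ i ∈ J, κ i) : I = J := by
  rcases Nat.lt_or_ge 1 I.card with h1 | h1
  · rcases Nat.lt_or_ge I.card n with h2 | h2
    · exact hκ.2 I J h1 h2 hcard.symm hsum
    · have hI := Finset.eq_univ_of_card I (le_antisymm (Finset.card_le_univ I) (by simpa using h2))
      rw [hcard] at h2
      have hJ := Finset.eq_univ_of_card J (le_antisymm (Finset.card_le_univ J) (by simpa using h2))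
      rw [hI, hJ]
  · rcases Nat.le_one_iff_eq_zero_or_eq_one.1 h1 with h | h
    · rw [h] at hcard
      rw [Finset.card_eq_zero.1 h, Finset.card_eq_zero.1 hcard.symm]
    · rw [h] at hcard
      obtain ⟨i, rfl⟩ := Finset.card_eq_one.1 h
      obtain ⟨j, rfl⟩ := Finset.card_eq_one.1 hcard.symm
      rw [Finset.sum_singleton, Finset.sum_singleton] at hsum
      rw [hκ.1.injective hsum]

lemma IsGeneric.eq_of_add_eq (hκ : IsGeneric κ) (hab : a < b) (hab' : a' < b')
    (h : κ a + κ b = κ a' + κ b') : a = a' ∧ b = b' := by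
  have h1 : ({a, b} : Finset (Fin n)) = {a', b'} := by
    refine hκ.eq_of_sum_eq ?_ ?_
    · rw [Finset.card_pair hab.ne, Finset.card_pair hab'.ne]
    · rw [Finset.sum_pair hab.ne, Finset.sum_pair hab'.ne, h]
  have h2 : a ∈ ({a', b'} : Finset (Fin n)) := by rw [← h1]; simp
  have h3 : b ∈ ({a', b'} : Finset (Fin n)) := by rw [← h1]; simp
  simp only [Finset.mem_insert, Finset.mem_singleton] at h2 h3
  omega

/-- The growth rate of the phases along the lines `x = -c y + d`, for `σ y → ∞`. -/
def rate (κ : Fin n → ℝ) (σ c : ℝ) (i : Fin n) : ℝ := σ * (κ i ^ 2 - c * κ i)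

lemma rate_sub (κ : Fin n → ℝ) (σ : ℝ) (a b i : Fin n) :
    rate κ σ (κ a + κ b) i - rate κ σ (κ a + κ b) a = σ * ((κ i - κ a) * (κ i - κ b)) := by
  simp only [rate]; ring

lemma onlyTie_rate (hκ : IsGeneric κ) (hσ : σ ≠ 0) (hab : a < b) :
    OnlyTie (rate κ σ (κ a + κ b)) a b := by
  refine ⟨hab.ne, by simp only [rate]; ring, fun i j hij h => ?_⟩
  have h1 : σ * ((κ i - κ j) * (κ i + κ j - (κ a + κ b))) = 0 := by
    simp only [rate] at h
    linear_combination h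
  have h2 := (mul_eq_zero.1 ((mul_eq_zero.1 h1).resolve_left hσ)).resolve_left
    (sub_ne_zero.2 (hκ.1.injective.ne hij))
  rcases lt_or_gt_of_ne hij with h | h
  · exact Or.inl (hκ.eq_of_add_eq h hab (by linarith)).1
  · exact Or.inr (hκ.eq_of_add_eq h hab (by linarith)).2

lemma setOf_rate_lt_one (hκ : IsGeneric κ) (hab : a < b) :
    {i | rate κ 1 (κ a + κ b) a < rate κ 1 (κ a + κ b) i} = arc b a := by
  ext i
  rw [Set.mem_ofPred_eq, ← sub_pos, rate_sub, one_mul, mul_pos_iff, mem_arc]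
  simp only [sub_pos, sub_neg, hκ.1.lt_iff_lt]
  omega

lemma setOf_rate_lt_neg_one (hκ : IsGeneric κ) (hab : a < b) :
    {i | rate κ (-1) (κ a + κ b) a < rate κ (-1) (κ a + κ b) i} = arc a b := by
  ext i
  rw [Set.mem_ofPred_eq, ← sub_pos, rate_sub, neg_one_mul, neg_pos, mul_neg_iff, mem_arc]
  simp only [sub_pos, sub_neg, hκ.1.lt_iff_lt]
  omega

lemma sum_rate (J : Finset (Fin n)) :
    ∑ i ∈ J, rate κ σ c i = σ * (∑ i ∈ J, κ i ^ 2 - c * ∑ i ∈ J, κ i) := by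
  simp only [rate, Finset.mul_sum, Finset.sum_sub_distrib, mul_sub]

lemma logTerm_on_line (hσ : σ * σ = 1) (d : ℝ) (hq : q.1 = -c * q.2 + d) :
    logTerm A κ t m s J q = (logTerm A κ t m s J 0 + (∑ i ∈ J, κ i) * d) +
      (∑ i ∈ J, rate κ σ c i) * (σ * q.2) := by
  rw [logTerm_eq, sum_rate, hq]
  linear_combination (-(∑ i ∈ J, κ i ^ 2) * q.2 + c * (∑ i ∈ J, κ i) * q.2) * hσ

lemma isBasisSet_of_separates (h : Separates A κ t m s L I J) :
    IsBasisSet A.col I ∧ IsBasisSet A.col J := by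
  obtain ⟨-, rfl, hL⟩ := h
  obtain ⟨q, hq⟩ := hL.nonempty
  exact ⟨minor_ne_zero_iff.1 (minor_ne_zero_of_mem_closure hq.1),
    minor_ne_zero_iff.1 (minor_ne_zero_of_mem_closure hq.2)⟩

/-- Along an unbounded edge, the terms on both sides have maximal growth rate. -/
lemma Separates.exists_isMaxBasis (hκ : IsGeneric κ) (hσ : σ * σ = 1)
    (h : Separates A κ t m s L I J) (hL : ∀ Y, ∃ q ∈ L, Y < σ * q.2) :
    ∃ c d, (∀ q ∈ L, q.1 = -c * q.2 + d) ∧ IsMaxBasis A.col (rate κ σ c) I ∧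
      IsMaxBasis A.col (rate κ σ c) J := by
  obtain ⟨hI, hJ⟩ := isBasisSet_of_separates h
  obtain ⟨hne, hLeq, -⟩ := h
  have hX : ∑ i ∈ I, κ i - ∑ i ∈ J, κ i ≠ 0 := fun h =>
    hne (hκ.eq_of_sum_eq (hI.card_eq.trans hJ.card_eq.symm) (sub_eq_zero.1 h))
  set X := ∑ i ∈ I, κ i - ∑ i ∈ J, κ i
  -- On `L` the terms of `I` and `J` agree; as `X ≠ 0`, this equation can be solved for `x`.
  have hline : ∀ q ∈ L, q.1 = -((∑ i ∈ I, κ i ^ 2 - ∑ i ∈ J, κ i ^ 2) / X) * q.2 +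
      (logTerm A κ t m s J 0 - logTerm A κ t m s I 0) / X := by
    intro q hq
    rw [hLeq] at hq
    have h1 := le_antisymm (logTerm_le_of_mem_closure hq.1 (minor_ne_zero_iff.2 hJ))
      (logTerm_le_of_mem_closure hq.2 (minor_ne_zero_iff.2 hI))
    rw [logTerm_eq A κ t m s J, logTerm_eq A κ t m s I] at h1
    field_simp
    simp only [X]
    linear_combination -h1
  have hmax : ∀ I c d, IsBasisSet A.col I → (∀ q ∈ L, q.1 = -c * q.2 + d) →
      (L ⊆ closure (region A κ t m s I)) → IsMaxBasis A.col (rate κ σ c) I := by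
    refine fun I c d hI hline hsub => ⟨hI, fun K hK => ?_⟩
    by_contra! hlt
    set D := ((logTerm A κ t m s I 0 + (∑ i ∈ I, κ i) * d) -
      (logTerm A κ t m s K 0 + (∑ i ∈ K, κ i) * d)) with hD
    -- Beyond this threshold the faster growing term `K` overtakes `I`, although `I` is dominant on
    -- all of `L`.
    obtain ⟨q, hq, hY⟩ := hL (D / (∑ i ∈ K, rate κ σ c i - ∑ i ∈ I, rate κ σ c i))
    rw [div_lt_iff₀ (sub_pos.2 hlt)] at hY
    have h1 := logTerm_le_of_mem_closure (hsub hq) (minor_ne_zero_iff.2 hK)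
    rw [logTerm_on_line hσ d (hline q hq), logTerm_on_line hσ d (hline q hq)] at h1
    linarith
  refine ⟨_, _, hline, hmax I _ _ hI hline ?_, hmax J _ _ hJ hline ?_⟩
  · rw [hLeq]; exact Set.inter_subset_left
  · rw [hLeq]; exact Set.inter_subset_right

/-- If exactly two terms have maximal growth rate, an unbounded edge separates their regions. -/
lemma separates_of_isMaxBasis (hκ : IsGeneric κ) (hσ : σ * σ = 1) (hne : I ≠ J)
    (hI : IsMaxBasis A.col (rate κ σ c) I) (hJ : IsMaxBasis A.col (rate κ σ c) J)
    (h : ∀ K, IsMaxBasis A.col (rate κ σ c) K → K = I ∨ K = J) :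
    ∃ L, Separates A κ t m s L I J ∧ ∀ Y, ∃ q ∈ L, Y < σ * q.2 := by
  have hX : ∑ i ∈ I, κ i - ∑ i ∈ J, κ i ≠ 0 := fun h =>
    hne (hκ.eq_of_sum_eq (hI.1.card_eq.trans hJ.1.card_eq.symm) (sub_eq_zero.1 h))
  have hW : ∑ i ∈ I, rate κ σ c i = ∑ i ∈ J, rate κ σ c i :=
    le_antisymm (hJ.2 I hI.1) (hI.2 J hJ.1)
  set X := ∑ i ∈ I, κ i - ∑ i ∈ J, κ i with hXdef
  -- The growth rates being equal, this intercept makes the two terms agree along the whole line.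
  set d := (logTerm A κ t m s J 0 - logTerm A κ t m s I 0) / X with hd
  have hdX : d * X = logTerm A κ t m s J 0 - logTerm A κ t m s I 0 := by
    rw [hd]; field_simp
  let f : ℝ → ℝ × ℝ := fun u => (-c * (σ * u) + d, σ * u)
  have hf : ∀ u, σ * (f u).2 = u := fun u => by
    simp only [f]; rw [← mul_assoc, hσ, one_mul]
  have hval : ∀ K u, logTerm A κ t m s K (f u) =
      (logTerm A κ t m s K 0 + (∑ i ∈ K, κ i) * d) + (∑ i ∈ K, rate κ σ c i) * u := fun K u => by
    rw [logTerm_on_line (q := f u) hσ d rfl, hf]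
  have hIJ : ∀ u, logTerm A κ t m s I (f u) = logTerm A κ t m s J (f u) := fun u => by
    rw [hval, hval, hW]
    rw [hXdef] at hdX
    linear_combination hdX
  have hev : ∀ᶠ u in Filter.atTop, ∀ K, minor A K ≠ 0 → K ≠ I → K ≠ J →
      logTerm A κ t m s K (f u) < logTerm A κ t m s I (f u) := by
    rw [Filter.eventually_all]
    intro K
    by_cases hK : minor A K ≠ 0 ∧ K ≠ I ∧ K ≠ J
    · obtain ⟨hKm, hKI, hKJ⟩ := hK
      have hlt : ∑ i ∈ K, rate κ σ c i < ∑ i ∈ I, rate κ σ c i := by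
        by_contra! hle
        exact (h K ⟨minor_ne_zero_iff.1 hKm, fun M hM => (hI.2 M hM).trans hle⟩).elim hKI hKJ
      filter_upwards [Filter.eventually_gt_atTop
        (((logTerm A κ t m s K 0 + (∑ i ∈ K, κ i) * d) -
          (logTerm A κ t m s I 0 + (∑ i ∈ I, κ i) * d)) /
          (∑ i ∈ I, rate κ σ c i - ∑ i ∈ K, rate κ σ c i))] with u hu _ _ _
      rw [div_lt_iff₀ (sub_pos.2 hlt)] at hu
      rw [hval, hval]
      linarith
    · exact Filter.Eventually.of_forall fun p h1 h2 h3 => absurd ⟨h1, h2, h3⟩ hK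
  obtain ⟨u₀, hu₀⟩ := Filter.eventually_atTop.1 hev
  have hmem : ∀ u, u₀ ≤ u →
      f u ∈ closure (region A κ t m s I) ∩ closure (region A κ t m s J) := fun u hu => by
    refine ⟨mem_closure_region (minor_ne_zero_iff.2 hI.1) (sub_ne_zero.1 hX) (hIJ u).ge
      (hu₀ u hu), mem_closure_region (minor_ne_zero_iff.2 hJ.1) (sub_ne_zero.1 hX).symm (hIJ u).le
      fun K hK hKJ hKI => hIJ u ▸ hu₀ u hu K hK hKI hKJ⟩
  refine ⟨_, ⟨hne, rfl, f u₀, hmem u₀ le_rfl, f (u₀ + 1), hmem _ (by linarith), fun h => ?_⟩,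
    fun Y => ⟨f (max u₀ (Y + 1)), hmem _ (le_max_left _ _), ?_⟩⟩
  · have h1 := hf u₀
    rw [h, hf] at h1
    linarith
  · rw [hf]
    exact lt_of_lt_of_le (lt_add_one Y) (le_max_right _ _)

/-- The edges of the contour plot that are unbounded in the direction `σ y → ∞`. -/
def solitonsAt (A : Matrix (Fin k) (Fin n) ℝ) (κ : Fin n → ℝ) (t : ℝ) (m : ℕ) (s : ℕ → ℝ) (σ : ℝ) :
    Set (Set (ℝ × ℝ)) :=
  {L | (∃ I J, Separates A κ t m s L I J) ∧ ∀ Y : ℝ, ∃ q ∈ L, Y < σ * q.2}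

lemma solitonsAt_one : solitonsAt A κ t m s 1 = solitonsAtTop A κ t m s := by
  simp [solitonsAt, solitonsAtTop]

lemma solitonsAt_neg_one : solitonsAt A κ t m s (-1) = solitonsAtBot A κ t m s := by
  ext L
  refine and_congr_right fun _ => ⟨fun h Y => ?_, fun h Y => ?_⟩
  · obtain ⟨q, hq, h⟩ := h (-Y)
    exact ⟨q, hq, by linarith⟩
  · obtain ⟨q, hq, h⟩ := h (-Y)
    exact ⟨q, hq, by linarith⟩

/-- The slope of an unbounded edge of type `[a, b]`, and the dominant terms along it. -/
lemma HasType.exists_isMaxBasis (hκ : IsGeneric κ) (hσ : σ * σ = 1)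
    (hL : ∀ Y, ∃ q ∈ L, Y < σ * q.2) (hab : a < b) (h : HasType A κ t m s L a b) :
    (∃ d, ∀ q ∈ L, q.1 = -(κ a + κ b) * q.2 + d) ∧ ∃ I J, Separates A κ t m s L I J ∧
      I \ J = {a} ∧ J \ I = {b} ∧ IsMaxBasis A.col (rate κ σ (κ a + κ b)) I ∧
        IsMaxBasis A.col (rate κ σ (κ a + κ b)) J := by
  obtain ⟨I, J, hsep, hIJ, hJI⟩ := h
  obtain ⟨c, d, hline, hI, hJ⟩ := hsep.exists_isMaxBasis hκ hσ hL
  -- Both bases have the same weight and differ by exchanging `a` and `b`, so these two have equal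
  -- rates.
  have hc : c = κ a + κ b := by
    have hW : ∑ i ∈ I, rate κ σ c i = ∑ i ∈ J, rate κ σ c i :=
      le_antisymm (hJ.2 I hI.1) (hI.2 J hJ.1)
    have h1 := Finset.sum_sdiff_sub_sum_sdiff (s₁ := I) (s₂ := J) (f := rate κ σ c)
    rw [hW, hIJ, hJI, Finset.sum_singleton, Finset.sum_singleton, sub_self] at h1
    have h2 : (κ a - κ b) * (κ a + κ b - c) = 0 := by
      simp only [rate] at h1
      linear_combination -σ * h1 - (κ a ^ 2 - c * κ a - κ b ^ 2 + c * κ b) * hσ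
    have h3 := (mul_eq_zero.1 h2).resolve_left (sub_ne_zero.2 (hκ.1 hab).ne)
    linarith
  subst hc
  exact ⟨⟨d, hline⟩, I, J, hsep, hIJ, hJI, hI, hJ⟩

/-- The edge contains points of different heights, so its slope fixes `κ a + κ b`, and by genericity
the pair. -/
lemma HasType.unique (hκ : IsGeneric κ) (hσ : σ * σ = 1) (hL : L ∈ solitonsAt A κ t m s σ)
    (hab : a < b) (hab' : a' < b') (h : HasType A κ t m s L a b)
    (h' : HasType A κ t m s L a' b') : a = a' ∧ b = b' := by
  obtain ⟨⟨d, hd⟩, -⟩ := h.exists_isMaxBasis hκ hσ hL.2 hab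
  obtain ⟨⟨d', hd'⟩, -⟩ := h'.exists_isMaxBasis hκ hσ hL.2 hab'
  obtain ⟨q, hq, -⟩ := hL.2 0
  obtain ⟨p, hp, hpq⟩ := hL.2 (σ * q.2)
  refine hκ.eq_of_add_eq hab hab' ?_
  have h1 : (κ a + κ b - (κ a' + κ b')) * (p.2 - q.2) = 0 := by
    linear_combination hd p hp - hd' p hp + hd' q hq - hd q hq
  have h2 : p.2 - q.2 ≠ 0 := fun h => by
    rw [sub_eq_zero.1 h] at hpq
    exact lt_irrefl _ hpq
  exact sub_eq_zero.1 ((mul_eq_zero.1 h1).resolve_right h2)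

/-- Only one maximal basis contains `a` and only one contains `b`, so both edges separate the same
two regions. -/
lemma eq_of_hasType (hκ : IsGeneric κ) (hσ : σ * σ = 1) (hL : L ∈ solitonsAt A κ t m s σ)
    (hL' : L' ∈ solitonsAt A κ t m s σ) (hab : a < b) (h : HasType A κ t m s L a b)
    (h' : HasType A κ t m s L' a b) : L = L' := by
  have hσ0 : σ ≠ 0 := by rintro rfl; simp at hσ
  obtain ⟨-, I, J, hs, hIJ, hJI, hI, hJ⟩ := h.exists_isMaxBasis hκ hσ hL.2 hab
  obtain ⟨-, I', J', hs', hIJ', hJI', hI', hJ'⟩ := h'.exists_isMaxBasis hκ hσ hL'.2 hab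
  have htie := onlyTie_rate hκ hσ0 hab
  have ha : a ∈ I := (Finset.mem_sdiff.1 (by rw [hIJ]; simp : a ∈ I \ J)).1
  have ha' : a ∈ I' := (Finset.mem_sdiff.1 (by rw [hIJ']; simp : a ∈ I' \ J')).1
  have hb : b ∈ J := (Finset.mem_sdiff.1 (by rw [hJI]; simp : b ∈ J \ I)).1
  have hb' : b ∈ J' := (Finset.mem_sdiff.1 (by rw [hJI']; simp : b ∈ J' \ I')).1
  obtain rfl := hI.eq_of_mem htie hI' ha ha'
  obtain rfl := hJ.eq_of_mem htie.symm hJ' hb hb'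
  exact hs.2.1.trans hs'.2.1.symm

lemma Separates.symm (h : Separates A κ t m s L I J) : Separates A κ t m s L J I :=
  ⟨h.1.symm, by rw [h.2.1, Set.inter_comm], h.2.2⟩

lemma exists_hasType (hκ : IsGeneric κ) (hσ : σ * σ = 1) (hL : L ∈ solitonsAt A κ t m s σ) :
    ∃ a b, a < b ∧ HasType A κ t m s L a b := by
  have hσ0 : σ ≠ 0 := by rintro rfl; simp at hσ
  obtain ⟨⟨I, J, h⟩, hY⟩ := hL
  obtain ⟨c, d, -, hI, hJ⟩ := h.exists_isMaxBasis hκ hσ hY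
  have hninj : ¬ Function.Injective (rate κ σ c) := fun hinj => h.1 (hI.eq_of_injective hinj hJ)
  have htie : ∃ a b, a < b ∧ rate κ σ c a = rate κ σ c b := by
    simp only [Function.Injective, not_forall] at hninj
    obtain ⟨a, b, hr, hne⟩ := hninj
    rcases lt_or_gt_of_ne hne with h | h
    · exact ⟨a, b, h, hr⟩
    · exact ⟨b, a, h, hr.symm⟩
  obtain ⟨a, b, hab, hr⟩ := htie
  obtain rfl : c = κ a + κ b := by
    have h2 : σ * ((κ a - κ b) * (κ a + κ b - c)) = 0 := by
      simp only [rate] at hr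
      linear_combination hr
    have h3 := ((mul_eq_zero.1 ((mul_eq_zero.1 h2).resolve_left hσ0))).resolve_left
      (sub_ne_zero.2 (hκ.1 hab).ne)
    linarith
  refine ⟨a, b, hab, ?_⟩
  rcases hI.sdiff_eq (onlyTie_rate hκ hσ0 hab) hJ h.1 with h1 | h1
  · exact ⟨I, J, h, h1⟩
  · exact ⟨J, I, h.symm, h1.symm⟩

lemma exists_hasType_iff_link (hκ : IsGeneric κ) (hσ : σ * σ = 1) (hJ : IsBasisSet A.col J)
    (hab : a < b) : (∃ L ∈ solitonsAt A κ t m s σ, HasType A κ t m s L a b) ↔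
      Link A.col {i | rate κ σ (κ a + κ b) a < rate κ σ (κ a + κ b) i} a b := by
  have hσ0 : σ ≠ 0 := by rintro rfl; simp at hσ
  have htie := onlyTie_rate hκ hσ0 hab
  constructor
  · rintro ⟨L, hL, h⟩
    obtain ⟨-, I, J, -, -, hJI, hI, hJ⟩ := h.exists_isMaxBasis hκ hσ hL.2 hab
    have hb := Finset.mem_sdiff.1 (by rw [hJI]; simp : b ∈ J \ I)
    exact hI.link htie hJ hb.1 hb.2
  · intro h
    obtain ⟨I, J, hI, hJ, hIJ, hJI, huniq⟩ := h.exists_pair htie hJ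
    have hne : I ≠ J := by
      rintro rfl
      simp at hIJ
    obtain ⟨L, hs, hY⟩ := separates_of_isMaxBasis hκ hσ hne hI hJ huniq
    exact ⟨L, ⟨⟨I, J, hs⟩, hY⟩, I, J, hs, hIJ, hJI⟩

end Asymptotics

/-! ### Row spans and reduced echelon matrices -/

section Echelon

variable {k n : ℕ} {A A' : Matrix (Fin k) (Fin n) ℝ} {J : Finset (Fin n)}
  {M : Finset (Finset (Fin n))}

lemma rowSpan_mul_le (g : Matrix (Fin k) (Fin k) ℝ) (A : Matrix (Fin k) (Fin n) ℝ) :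
    rowSpan (g * A) ≤ rowSpan A := by
  refine Submodule.span_le.2 ?_
  rintro _ ⟨a, rfl⟩
  refine (Submodule.mem_span_range_iff_exists_fun ℝ).2 ⟨g a, ?_⟩
  ext j
  simp [Matrix.mul_apply]

lemma exists_mul_of_rowSpan_le (h : rowSpan A ≤ rowSpan A') :
    ∃ g : Matrix (Fin k) (Fin k) ℝ, A = g * A' := by
  have h1 : ∀ a, ∃ c : Fin k → ℝ, ∑ b, c b • A' b = A a := fun a =>
    (Submodule.mem_span_range_iff_exists_fun ℝ).1 (h (Submodule.subset_span ⟨a, rfl⟩))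
  choose g hg using h1
  refine ⟨Matrix.of g, ?_⟩
  ext a j
  rw [← hg a]
  simp [Matrix.mul_apply]

lemma minor_mul (g : Matrix (Fin k) (Fin k) ℝ) (A : Matrix (Fin k) (Fin n) ℝ)
    (J : Finset (Fin n)) : minor (g * A) J = g.det * minor A J := by
  unfold minor
  split_ifs with h
  · rw [← Matrix.det_mul]
    rfl
  · simp

/-- Matrices with the same row span differ by a left factor, which scales all maximal minors by its
determinant. -/
lemma mem_iff_minor_ne_zero (hV : rowSpan A ∈ positroidCell k n M) : J ∈ M ↔ minor A J ≠ 0 := by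
  obtain ⟨-, A', hA', hpos, hzero⟩ := hV
  obtain ⟨g, hg⟩ := exists_mul_of_rowSpan_le hA'.le
  obtain ⟨g', hg'⟩ := exists_mul_of_rowSpan_le hA'.ge
  constructor
  · intro hJ h
    have := hpos J hJ
    rw [hg, minor_mul, h, mul_zero] at this
    exact lt_irrefl _ this
  · intro h
    by_contra hJ
    rw [hg', minor_mul, hzero J hJ, mul_zero] at h
    exact h rfl

lemma exists_isBasisSet (h : rowSpan A ∈ grassmannian k n) : ∃ J, IsBasisSet A.col J := by
  classical
  have h1 : Module.finrank ℝ (Submodule.span ℝ (Set.range A.col)) = k := by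
    rw [← Matrix.rank_eq_finrank_span_cols, Matrix.rank_eq_finrank_span_row]
    exact h
  have h2 : Submodule.span ℝ (Set.range A.col) = ⊤ :=
    Submodule.eq_top_of_finrank_eq (by rw [h1]; simp)
  obtain ⟨b, -, -, hb, hli⟩ := exists_linearIndepOn_extension (linearIndepOn_empty ℝ A.col)
    (Set.empty_subset Set.univ)
  refine ⟨b.toFinset, by simpa using hli, ?_⟩
  rw [Set.coe_toFinset, eq_top_iff, ← h2, ← Set.image_univ]
  exact Submodule.span_le.2 hb

/-- The pivots form the lexicographically first basis. Each column is spanned by the pivot columns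
up to it, which gives the zeros left of a pivot. The index `i` only ensures `0 < n`. -/
lemma exists_isReducedEchelon (h : IsBasisSet A.col J) (i : Fin n) :
    ∃ (p : Fin k → Fin n) (g : Matrix (Fin k) (Fin k) ℝ), IsBasisSet A.col (Finset.univ.image p) ∧
      rowSpan (g * A) = rowSpan A ∧ IsReducedEchelon (g * A) p := by
  have hr : ∀ j l, cyclicLT ⟨0, i.pos⟩ j l ↔ j < l := fun j l => by
    rw [cyclicLT_iff]
    simp only [Fin.le_def, Fin.lt_def]
    omega
  have hP := isBasisSet_lexMinBasis h ⟨0, i.pos⟩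
  have hspan := mem_span_lexMinBasis A.col ⟨0, i.pos⟩
  simp only [hr] at hspan
  set P := lexMinBasis A.col ⟨0, i.pos⟩
  have hc := (isBasisSet_col_iff.1 hP).1
  have hunit := (linearIndepOn_col_iff hc).1 hP.1
  rw [Matrix.isUnit_iff_isUnit_det] at hunit
  set p := P.orderEmbOfFin hc
  set Q := A.submatrix id p
  have hBp : ∀ a b, (Q⁻¹ * A) a (p b) = if a = b then 1 else 0 := fun a b => by
    have h1 : (Q⁻¹ * A) a (p b) = (Q⁻¹ * Q) a b := rfl
    rw [h1, Matrix.nonsing_inv_mul _ hunit, Matrix.one_apply]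
  refine ⟨p, Q⁻¹, ?_, le_antisymm (rowSpan_mul_le _ _) ?_, p.strictMono, hBp, fun a j hj => ?_⟩
  · simpa [p] using hP
  · conv_lhs => rw [← Matrix.mul_nonsing_inv_cancel_left Q A hunit]
    exact rowSpan_mul_le _ _
  · let φ : (Fin k → ℝ) →ₗ[ℝ] ℝ := LinearMap.proj a ∘ₗ Matrix.mulVecLin Q⁻¹
    have hφ : ∀ l, φ (A.col l) = (Q⁻¹ * A) a l := fun l => rfl
    have hle : Submodule.span ℝ (A.col '' {l | l ∈ P ∧ (l = j ∨ l < j)}) ≤ LinearMap.ker φ := by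
      refine Submodule.span_le.2 ?_
      rintro _ ⟨l, ⟨hlP, hlj⟩, rfl⟩
      have hl : l ∈ Set.range p := by
        rw [Finset.range_orderEmbOfFin]
        exact hlP
      obtain ⟨b, rfl⟩ := hl
      rw [SetLike.mem_coe, LinearMap.mem_ker, hφ, hBp, if_neg]
      rintro rfl
      omega
    rw [← hφ]
    exact hle (hspan j)

lemma IsIrreducibleCell.col_ne_zero (hM : IsIrreducibleCell k n M)
    (hV : rowSpan A ∈ positroidCell k n M) (i : Fin n) : A.col i ≠ 0 := by
  obtain ⟨J, hJ⟩ := exists_isBasisSet hV.1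
  obtain ⟨p, g, -, hg, hB⟩ := exists_isReducedEchelon hJ i
  obtain ⟨a, ha⟩ := (hM.2 _ hV _ p hg hB).1 i
  intro h
  refine ha ?_
  have h1 : ∀ b, A b i = 0 := fun b => congrFun h b
  simp [Matrix.mul_apply, h1]

/-- A non-pivot column is spanned by the pivot columns. For a pivot, a second nonzero entry of its
row allows exchanging it for that column, giving a basis that avoids the pivot. -/
lemma IsIrreducibleCell.col_mem_span (hM : IsIrreducibleCell k n M)
    (hV : rowSpan A ∈ positroidCell k n M) (i : Fin n) :
    A.col i ∈ Submodule.span ℝ (A.col '' {i}ᶜ) := by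
  obtain ⟨J, hJ⟩ := exists_isBasisSet hV.1
  obtain ⟨p, g, hp, hg, hB⟩ := exists_isReducedEchelon hJ i
  by_cases hi : i ∈ Finset.univ.image p
  · obtain ⟨a, -, rfl⟩ := Finset.mem_image.1 hi
    obtain ⟨j, hj, hne⟩ := (hM.2 _ hV _ p hg hB).2 a
    let φ : (Fin k → ℝ) →ₗ[ℝ] ℝ := LinearMap.proj a ∘ₗ Matrix.mulVecLin g
    have hφ : ∀ l, φ (A.col l) = (g * A) a l := fun l => rfl
    have hjs : A.col j ∉ Submodule.span ℝ
        (A.col '' ((Finset.univ.image p : Finset (Fin n)) \ {p a} : Set (Fin n))) := by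
      intro hmem
      have hle : Submodule.span ℝ (A.col ''
          ((Finset.univ.image p : Finset (Fin n)) \ {p a} : Set (Fin n))) ≤ LinearMap.ker φ := by
        refine Submodule.span_le.2 ?_
        rintro _ ⟨l, ⟨hl, hla⟩, rfl⟩
        obtain ⟨b, -, rfl⟩ := Finset.mem_image.1 (Finset.mem_coe.1 hl)
        rw [SetLike.mem_coe, LinearMap.mem_ker, hφ, hB.2.1, if_neg]
        rintro rfl
        exact hla rfl
      have := hle hmem
      rw [LinearMap.mem_ker, hφ] at this
      exact hne this
    refine mem_span_mono ?_ ((hp.exchange hi hjs).mem_span _)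
    intro l hl
    rw [Finset.mem_coe, Finset.mem_insert, Finset.mem_erase] at hl
    rcases hl with rfl | hl
    · exact hj
    · exact hl.1
  · refine mem_span_mono ?_ (hp.mem_span _)
    intro l hl h
    exact hi (Set.mem_singleton_iff.1 h ▸ hl)

end Echelon

/-- An enumeration of unbounded edges from an enumeration of the linked pairs. -/
lemma exists_enumeration {k n N : ℕ} {A : Matrix (Fin k) (Fin n) ℝ} {κ : Fin n → ℝ}
    (hκ : IsGeneric κ) {t : ℝ} {m : ℕ} {s : ℕ → ℝ} {σ : ℝ} (hσ : σ * σ = 1)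
    {x y : Fin N → Fin n} (hlt : ∀ r, x r < y r)
    (hinj : ∀ r r', x r = x r' → y r = y r' → r = r')
    (hxy : ∀ a b, a < b → ((∃ L ∈ solitonsAt A κ t m s σ, HasType A κ t m s L a b) ↔
      ∃ r, x r = a ∧ y r = b)) :
    ∃ L : Fin N → Set (ℝ × ℝ), Function.Injective L ∧ Set.range L = solitonsAt A κ t m s σ ∧
      ∀ r, x r < y r ∧ ∀ a b, a < b → (HasType A κ t m s (L r) a b ↔ a = x r ∧ b = y r) := by
  choose L hL hT using fun r => (hxy (x r) (y r) (hlt r)).2 ⟨r, rfl, rfl⟩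
  refine ⟨L, fun r r' h => ?_, ?_, fun r => ⟨hlt r, fun a b hab => ⟨fun h => ?_, ?_⟩⟩⟩
  · have h1 := (hT r).unique hκ hσ (hL r) (hlt r) (hlt r') (h ▸ hT r')
    exact hinj r r' h1.1 h1.2
  · refine Set.Subset.antisymm (Set.range_subset_iff.2 hL) fun L' hL' => ?_
    obtain ⟨a, b, hab, h⟩ := exists_hasType hκ hσ hL'
    obtain ⟨r, rfl, rfl⟩ := (hxy a b hab).1 ⟨L', hL', h⟩
    exact ⟨r, eq_of_hasType hκ hσ (hL r) hL' hab (hT r) h⟩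
  · exact h.unique hκ hσ (hL r) hab (hlt r) (hT r)
  · rintro ⟨rfl, rfl⟩
    exact hT r

end KPSoliton

theorem mainTheorem7 (k n : ℕ) (κ : Fin n → ℝ) (hκ : KPSoliton.IsGeneric κ)
    (M : Finset (Finset (Fin n))) (hM : KPSoliton.IsIrreducibleCell k n M)
    (V : Submodule ℝ (Fin n → ℝ)) (hV : V ∈ KPSoliton.positroidCell k n M)
    (A : Matrix (Fin k) (Fin n) ℝ) (hAV : KPSoliton.rowSpan A = V)
    (hA : ∀ I, 0 ≤ KPSoliton.minor A I)
    (t₀ : ℝ) (m : ℕ) (s : ℕ → ℝ) :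
    ∃ (Ltop : Fin k → Set (ℝ × ℝ)) (e j : Fin k → Fin n)
      (Lbot : Fin (n - k) → Set (ℝ × ℝ)) (i g : Fin (n - k) → Fin n),
      -- the `k` unbounded line-solitons at `y ≫ 0`, and their types `[e r, j r]`
      (Function.Injective Ltop ∧ Set.range Ltop = KPSoliton.solitonsAtTop A κ t₀ m s ∧
        ∀ r, e r < j r ∧ ∀ a b, a < b →
          (KPSoliton.HasType A κ t₀ m s (Ltop r) a b ↔ a = e r ∧ b = j r)) ∧
      -- the `n - k` unbounded line-solitons at `y ≪ 0`, and their types `[i r, g r]`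
      (Function.Injective Lbot ∧ Set.range Lbot = KPSoliton.solitonsAtBot A κ t₀ m s ∧
        ∀ r, i r < g r ∧ ∀ a b, a < b →
          (KPSoliton.HasType A κ t₀ m s (Lbot r) a b ↔ a = i r ∧ b = g r)) ∧
      -- each index is exactly one of the `e r`, `g r`, so that `π` below is determined by them
      Function.Bijective (Sum.elim e g) ∧
      ∃ π : Equiv.Perm (Fin n),
        (∀ r, π (e r) = j r) ∧ (∀ r, π (g r) = i r) ∧
        (∀ a, π a ≠ a) ∧ (Finset.univ.filter fun a => a < π a).card = k ∧
        V ∈ KPSoliton.positroidCellOfPerm k n π ∧ KPSoliton.IsCellPerm M π := by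
  open KPSoliton in
  subst hAV
  have h0 := hM.col_ne_zero hV
  have h1 := hM.col_mem_span hV
  obtain ⟨J, hJ⟩ := exists_isBasisSet hV.1
  obtain ⟨π, hπ, hl⟩ := exists_perm_link h0 h1
  have hcard : (Finset.univ.filter fun a => a < π a).card = k :=
    (card_excedances hJ hπ hl).trans (isBasisSet_col_iff.1 hJ).1
  have hcardc : (Finset.univ.filter fun a => a < π a)ᶜ.card = n - k := by
    rw [Finset.card_compl, hcard, Fintype.card_fin]
  have hcell : IsCellPerm M π := by
    refine ⟨lexMinBasis A.col, fun r => ⟨?_, fun K hK hne => ?_⟩,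
      isNecklacePerm_lexMinBasis h0 h1 hπ hl⟩
    · rw [mem_iff_minor_ne_zero hV, minor_ne_zero_iff]
      exact isBasisSet_lexMinBasis hJ r
    · rw [mem_iff_minor_ne_zero hV, minor_ne_zero_iff] at hK
      exact lexLT_lexMinBasis hK r hne
  let e := (Finset.univ.filter fun a => a < π a).orderEmbOfFin hcard
  let g := (Finset.univ.filter fun a => a < π a)ᶜ.orderEmbOfFin hcardc
  have he : ∀ a, (∃ r, e r = a) ↔ a < π a := fun a => by
    rw [← Set.mem_range, Finset.range_orderEmbOfFin]
    simp
  have hg : ∀ a, (∃ r, g r = a) ↔ π a < a := fun a => by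
    rw [← Set.mem_range, Finset.range_orderEmbOfFin]
    simp only [Finset.coe_compl, Finset.coe_filter, Finset.mem_univ, true_and, Set.mem_compl_iff,
      Set.mem_ofPred_eq, not_lt]
    exact ⟨fun h => lt_of_le_of_ne h (hπ a), le_of_lt⟩
  obtain ⟨Ltop, htop⟩ := exists_enumeration (A := A) (t := t₀) (m := m) (s := s) hκ
    (σ := 1) (by norm_num) (x := e) (y := fun r => π (e r)) (fun r => (he _).1 ⟨r, rfl⟩)
    (fun r r' h _ => e.injective h) fun a b hab => by
      rw [exists_hasType_iff_link hκ (by norm_num) hJ hab, setOf_rate_lt_one hκ hab,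
        hl a b hab.ne]
      constructor
      · rintro rfl
        obtain ⟨r, rfl⟩ := (he a).2 hab
        exact ⟨r, rfl, rfl⟩
      · rintro ⟨r, rfl, rfl⟩
        rfl
  obtain ⟨Lbot, hbot⟩ := exists_enumeration (A := A) (t := t₀) (m := m) (s := s) hκ
    (σ := -1) (by norm_num) (x := fun r => π (g r)) (y := g) (fun r => (hg _).1 ⟨r, rfl⟩)
    (fun r r' _ h => g.injective h) fun a b hab => by
      -- At the bottom the heavier arc runs from `a` to `b`, so the link reads `π b = a` instead of
      -- `π a = b`.
      have hsymm : Link A.col (arc a b) a b ↔ Link A.col (arc a b) b a := ⟨Link.symm, Link.symm⟩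
      rw [exists_hasType_iff_link hκ (by norm_num) hJ hab, setOf_rate_lt_neg_one hκ hab, hsymm,
        hl b a hab.ne']
      constructor
      · rintro rfl
        obtain ⟨r, rfl⟩ := (hg b).2 hab
        exact ⟨r, rfl, rfl⟩
      · rintro ⟨r, rfl, rfl⟩
        rfl
  rw [solitonsAt_one] at htop
  rw [solitonsAt_neg_one] at hbot
  refine ⟨Ltop, e, fun r => π (e r), Lbot, fun r => π (g r), g, htop, hbot, ⟨?_, fun a => ?_⟩, π,
    fun _ => rfl, fun _ => rfl, hπ, hcard, ⟨M, hcell, hV⟩, hcell⟩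
  · refine e.injective.sumElim g.injective fun r r' h => ?_
    have h2 := (he (e r)).1 ⟨r, rfl⟩
    have h3 := (hg (g r')).1 ⟨r', rfl⟩
    rw [h] at h2
    exact lt_asymm h2 h3
  · rcases lt_or_gt_of_ne (hπ a) with h | h
    · obtain ⟨r, hr⟩ := (hg a).2 h
      exact ⟨Sum.inr r, hr⟩
    · obtain ⟨r, hr⟩ := (he a).2 h
      exact ⟨Sum.inl r, hr⟩
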